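/- Let $G=\mathbb{SIM}(2)=\mathbb R^2\rtimes(\mathbb R_+\times SO(2))$ be the similitude group, with product $(b,a,\theta)(b',a',\theta')=(b+aR_\theta b',aa',\theta+\theta')$ and left Haar measure $d\mu=\dfrac{db\,da\,d\theta}{a^3}$. Let $\pi$ be its irreducible unitary representation on $L^2(\mathbb R^2)$, $$(\pi(b,a,\theta)\phi)(x)=a\,e^{-ib\cdot x}\phi(aR_{-\theta}x),$$ and take $\widehat G=\{\pi\}$ (the one-dimensional representations, which have Plancherel measure zero, are disregarded). Let $K$ be the Duflo–Moore operator $(K\phi)(x)=\|x\|^2\phi(x)$ on $L^2(\mathbb R^2)$, with powers $K^s$ given by multiplication by $\|x\|^{2s}$ on the maximal domain. Let $S_p$ be the Schatten class on $L^2(\mathbb R^2)$, $\|A\|_{S_p}^p=\operatorname{Tr}\,(A^*A)^{p/2}$, and let $L^p(G\times\widehat G,S_p)$ be the space of measurable functions $\sigma:x\mapsto\sigma(x)=\sigma(x,\pi)\in S_p$ on $G$ with $$\|\sigma\|_{p,\mu}^p=\int_G\|\sigma(x)K^{1/p}\|_{S_p}^p\,d\mu(x)<\infty .$$ For $f,g\in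 C_c^\infty(G)$ let $$W(f,g)(x)=\int_G f(x')\,g(x'^{-1}x)\,\pi(x')\,d\mu(x')$$ (weak operator-valued integral) be the Wigner transform. The Weyl transform $W_\sigma$ with symbol $\sigma$ is determined by $$\langle W_\sigma f,\overline g\rangle_{L^2(G)}=\int_G\operatorname{Tr}\bigl(\sigma(x)^*\,W(f,g)(x)\,K\bigr)\,d\mu(x),\qquad f,g\in C_c^\infty(G).$$ **Theorem.** For every $2<p<\infty$ there is a symbol $\sigma\in L^p(G\times\widehat G,S_p)$ such that $W_\sigma$ is not a bounded linear operator on $L^2(G)$. Precisely: for all $f,g\in C_c^\infty(G)$ the operator $\sigma(x)^*W(f,g)(x)K$ extends to a trace class operator for almost every $x$, and its trace is $\mu$-integrable in $x$; but there is no bounded linear operator $T$ on $L^2(G)$ with $$\int_G (Tf)\,g\,d\mu=\int_G\operatorname{Tr}\bigl(\sigma(x)^*W(f,g)(x)K\bigr)\,d\mu(x)\qquad\text{for all } f,g\in C_c^\infty(G).$$ -/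

import Mathlib

open MeasureTheory
open scoped ENNReal ComplexConjugate

noncomputable section

/-! ### Generalities: Schatten norms and traces of (densely defined) operators -/

section Operators

variable {H : Type*} [NormedAddCommGroup H] [InnerProductSpace ℂ H] [CompleteSpace H]

/-- `A` is a bounded, everywhere defined extension of the partially defined operator `T`.
It is unique when `T` is densely defined. -/
def IsBoundedExtension (T : H →ₗ.[ℂ] H) (A : H →L[ℂ] H) : Prop :=
  ∀ φ : T.domain, A φ = T φ

/-- The trace, in `[0, ∞]`, of a positive operator: the supremum of `∑ ⟨e, P e⟩` over all finite
orthonormal families. -/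
def posTrace (P : H →L[ℂ] H) : ℝ≥0∞ :=
  ⨆ (s : Finset H) (_ : Orthonormal ℂ (fun e : s => (e : H))),
    ∑ e ∈ s, ENNReal.ofReal (inner ℂ e (P e)).re

/-- `‖A‖_{S_r} ^ r = Tr ((A* A) ^ (r / 2))`, with the power taken in the functional calculus. -/
def schattenPow (r : ℝ) (A : H →L[ℂ] H) : ℝ≥0∞ :=
  posTrace ((star A * A) ^ (r / 2))

/-- `‖T‖_{S_r} ^ r` for a densely defined operator `T`: the value at its bounded extension, and `∞`
when there is none. -/
def schattenPowPMap (r : ℝ) (T : H →ₗ.[ℂ] H) : ℝ≥0∞ :=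
  ⨅ (A : H →L[ℂ] H) (_ : IsBoundedExtension T A), schattenPow r A

/-- The densely defined operator `T` extends to a trace class operator with trace `t`: for every
orthonormal basis, the series of the diagonal entries converges (unconditionally) to `t`. -/
def HasTrace (T : H →ₗ.[ℂ] H) (t : ℂ) : Prop :=
  ∃ A : H →L[ℂ] H, IsBoundedExtension T A ∧
    ∀ (v : Set H) (e : HilbertBasis v ℂ H), HasSum (fun i => inner ℂ (e i) (A (e i))) t

open Classical in
/-- The trace of a densely defined operator whose closure is trace class (and `0` otherwise). -/
def opTrace (T : H →ₗ.[ℂ] H) : ℂ :=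
  if h : ∃ t, HasTrace T t then h.choose else 0

end Operators

/-! ### The similitude group -/

/-- The similitude group `SIM(2) = ℝ² ⋊ (ℝ₊ × SO(2))`. The plane `ℝ²` is identified with `ℂ`, and the
dilation and rotation `(a, θ)` with the nonzero complex number `w = a e^{iθ}`, so that
`a R_θ x = w x`. The element `(b, w)` acts on the plane by `x ↦ w x + b`. -/
@[ext]
structure Sim2 where
  /-- the translation part -/
  b : ℂ
  /-- the dilation and rotation part `a e^{iθ}` -/
  w : ℂ
  w_ne : w ≠ 0

namespace Sim2

instance : Mul Sim2 := ⟨fun g h => ⟨g.b + g.w * h.b, g.w * h.w, mul_ne_zero g.w_ne h.w_ne⟩⟩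
instance : One Sim2 := ⟨⟨0, 1, one_ne_zero⟩⟩
instance : Inv Sim2 := ⟨fun g => ⟨-(g.w⁻¹ * g.b), g.w⁻¹, inv_ne_zero g.w_ne⟩⟩

@[simp] theorem mul_b (g h : Sim2) : (g * h).b = g.b + g.w * h.b := rfl
@[simp] theorem mul_w (g h : Sim2) : (g * h).w = g.w * h.w := rfl
@[simp] theorem one_b : (1 : Sim2).b = 0 := rfl
@[simp] theorem one_w : (1 : Sim2).w = 1 := rfl
@[simp] theorem inv_b (g : Sim2) : (g⁻¹).b = -(g.w⁻¹ * g.b) := rfl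
@[simp] theorem inv_w (g : Sim2) : (g⁻¹).w = g.w⁻¹ := rfl

instance : Group Sim2 :=
  Group.ofLeftAxioms
    (fun g h k => by ext <;> simp <;> ring)
    (fun g => by ext <;> simp)
    (fun g => by ext <;> simp [g.w_ne])

/-- The coordinates `(b, w)` of a group element. -/
def coord (g : Sim2) : ℂ × ℂ := (g.b, g.w)

instance : MeasurableSpace Sim2 := MeasurableSpace.comap coord inferInstance

theorem coord_injective : Function.Injective coord := fun g h hgh => by
  simp only [coord, Prod.mk.injEq] at hgh
  exact Sim2.ext hgh.1 hgh.2

theorem range_coord : Set.range coord = {z : ℂ × ℂ | z.2 ≠ 0} := by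
  ext z
  constructor
  · rintro ⟨g, rfl⟩
    exact g.w_ne
  · intro hz
    exact ⟨⟨z.1, z.2, hz⟩, rfl⟩

theorem isOpen_range : IsOpen {z : ℂ × ℂ | z.2 ≠ 0} := isOpen_ne_fun continuous_snd continuous_const

theorem measurableEmbedding_coord : MeasurableEmbedding coord where
  injective := coord_injective
  measurable := comap_measurable coord
  measurableSet_image' := by
    rintro _ ⟨t, ht, rfl⟩
    rw [Set.image_preimage_eq_inter_range, range_coord]
    exact ht.inter isOpen_range.measurableSet

/-- The left Haar measure `db da dθ / a³`. Since `da dθ = dw / a` and `a = |w|`, this is the measure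
`db dw / |w|⁴`, with `db` and `dw` the Lebesgue measure of the plane. -/
def haar : Measure Sim2 :=
  ((volume : Measure (ℂ × ℂ)).withDensity fun z => ENNReal.ofReal ((‖z.2‖ ^ 4)⁻¹)).comap coord

theorem map_coord_haar : haar.map coord =
    (volume : Measure (ℂ × ℂ)).withDensity fun z => ENNReal.ofReal ((‖z.2‖ ^ 4)⁻¹) := by
  rw [haar, measurableEmbedding_coord.map_comap, range_coord]
  refine Measure.restrict_eq_self_of_ae_mem ?_
  refine (withDensity_absolutelyContinuous _ _).ae_le ?_
  have h : ∀ᵐ w : ℂ, w ≠ 0 := by simp [ae_iff]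
  exact Measure.quasiMeasurePreserving_snd.ae h

/-- The same measure in the coordinates `(b, a, θ)`. -/
theorem lintegral_haar_polar (F : ℂ × ℂ → ℝ≥0∞) (hF : Measurable F) :
    ∫⁻ g, F g.coord ∂haar = ∫⁻ b : ℂ, ∫⁻ q in Set.Ioi (0 : ℝ) ×ˢ Set.Ioo (-Real.pi) Real.pi,
      F (b, q.1 * Complex.exp (q.2 * Complex.I)) * ENNReal.ofReal ((q.1 ^ 3)⁻¹) := by
  have hm : Measurable fun z : ℂ × ℂ => ENNReal.ofReal ((‖z.2‖ ^ 4)⁻¹) := by fun_prop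
  rw [← measurableEmbedding_coord.lintegral_map, map_coord_haar,
    lintegral_withDensity_eq_lintegral_mul _ hm hF, Measure.volume_eq_prod,
    lintegral_prod _ (hm.mul hF).aemeasurable]
  refine lintegral_congr fun b => ?_
  rw [← Complex.lintegral_comp_polarCoord_symm, polarCoord_target]
  refine setLIntegral_congr_fun (measurableSet_Ioi.prod measurableSet_Ioo) fun q hq => ?_
  have hq0 : 0 < q.1 := hq.1
  simp only [Complex.polarCoord_symm_apply, Pi.mul_apply, smul_eq_mul]
  have h1 : (q.1 : ℂ) * (Real.cos q.2 + Real.sin q.2 * Complex.I)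
      = q.1 * Complex.exp (q.2 * Complex.I) := by
    rw [Complex.exp_mul_I, Complex.ofReal_cos, Complex.ofReal_sin]
  have h2 : ‖(q.1 : ℂ) * Complex.exp (q.2 * Complex.I)‖ = q.1 := by
    rw [norm_mul, Complex.norm_exp_ofReal_mul_I, mul_one, Complex.norm_real, Real.norm_of_nonneg hq0.le]
  rw [h1, h2, ← mul_assoc, ← ENNReal.ofReal_mul hq0.le, mul_comm]
  congr 2
  field_simp

/-- The test functions `f ∈ C_c^∞(SIM(2))`: those which, in the coordinates `(b, w)` and extended by
zero, are smooth on `ℂ × ℂ` with compact support inside `{w ≠ 0}`. -/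
def IsTest (f : Sim2 → ℂ) : Prop :=
  ∃ F : ℂ × ℂ → ℂ, ContDiff ℝ (⊤ : ℕ∞) F ∧ HasCompactSupport F ∧
    tsupport F ⊆ {z | z.2 ≠ 0} ∧ ∀ g, f g = F g.coord

theorem IsTest.memLp {f : Sim2 → ℂ} (hf : IsTest f) : MemLp f 2 haar := by
  obtain ⟨F, hF, hc, hs, hfF⟩ := hf
  have hff : f = F ∘ coord := funext hfF
  rw [hff, ← measurableEmbedding_coord.memLp_map_measure_iff, map_coord_haar]
  obtain ⟨C, hC⟩ := hc.exists_bound_of_continuous hF.continuous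
  have hK : MeasurableSet (tsupport F) := (isClosed_tsupport F).measurableSet
  have hcont : ContinuousOn (fun z : ℂ × ℂ => (‖z.2‖ ^ 4)⁻¹) (tsupport F) :=
    ContinuousOn.inv₀ (by fun_prop) fun z hz => pow_ne_zero _ (norm_ne_zero_iff.mpr (hs hz))
  obtain ⟨D, hD⟩ := hc.isCompact.exists_bound_of_continuousOn hcont
  have hfin : ((volume : Measure (ℂ × ℂ)).withDensity fun z => ENNReal.ofReal ((‖z.2‖ ^ 4)⁻¹))
      (tsupport F) < ∞ := by
    rw [withDensity_apply _ hK]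
    calc ∫⁻ z in tsupport F, ENNReal.ofReal ((‖z.2‖ ^ 4)⁻¹)
        ≤ ∫⁻ _ in tsupport F, ENNReal.ofReal D := by
          refine setLIntegral_mono measurable_const fun z hz => ?_
          exact ENNReal.ofReal_le_ofReal ((le_abs_self _).trans (hD z hz))
      _ < ∞ := by
          rw [setLIntegral_const]
          exact ENNReal.mul_lt_top ENNReal.ofReal_lt_top hc.isCompact.measure_lt_top
  have hind : (tsupport F).indicator F = F :=
    Set.indicator_eq_self.mpr (subset_tsupport F)
  rw [← hind, memLp_indicator_iff_restrict hK]
  have : IsFiniteMeasure (((volume : Measure (ℂ × ℂ)).withDensity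
      fun z => ENNReal.ofReal ((‖z.2‖ ^ 4)⁻¹)).restrict (tsupport F)) :=
    ⟨by rwa [Measure.restrict_apply_univ]⟩
  exact MemLp.of_bound hF.continuous.aestronglyMeasurable C (Filter.Eventually.of_forall hC)

/-! ### The representation `π` and its Duflo–Moore operator -/

/-- The Hilbert space `L²(ℝ²)`. -/
abbrev L2Plane : Type := Lp ℂ 2 (volume : Measure ℂ)

/-- The pointwise formula `(π(b, a, θ) φ)(x) = a e^{-i b·x} φ(a R_{-θ} x)`. -/
def repFun (g : Sim2) (φ : ℂ → ℂ) (x : ℂ) : ℂ :=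
  ‖g.w‖ * Complex.exp (-(Complex.I * (inner ℝ g.b x : ℝ))) * φ (conj g.w * x)

theorem map_conj_mul (g : Sim2) : Measure.map (fun x : ℂ => conj g.w * x) volume =
    ENNReal.ofReal ((‖g.w‖ ^ 2)⁻¹) • (volume : Measure ℂ) := by
  have hdet : LinearMap.det (LinearMap.mulLeft ℝ (conj g.w)) = ‖g.w‖ ^ 2 := by
    have := Algebra.norm_complex_apply (conj g.w)
    rw [Algebra.norm_apply] at this
    rw [Complex.normSq_conj, Complex.normSq_eq_norm_sq] at this
    exact this
  have h0 : LinearMap.det (LinearMap.mulLeft ℝ (conj g.w)) ≠ 0 := by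
    rw [hdet]; exact pow_ne_zero _ (norm_ne_zero_iff.mpr g.w_ne)
  have := Measure.map_linearMap_addHaar_eq_smul_addHaar (volume : Measure ℂ) h0
  rw [hdet, abs_of_nonneg (by positivity)] at this
  exact this

theorem quasi_conj_mul (g : Sim2) :
    Measure.QuasiMeasurePreserving (fun x : ℂ => conj g.w * x) volume volume := by
  refine ⟨by fun_prop, ?_⟩
  rw [map_conj_mul]
  exact Measure.smul_absolutelyContinuous

theorem repFun_congr (g : Sim2) {φ ψ : ℂ → ℂ} (h : φ =ᵐ[volume] ψ) :
    repFun g φ =ᵐ[volume] repFun g ψ := by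
  filter_upwards [(quasi_conj_mul g).ae_eq_comp h] with x hx
  simp only [Function.comp_apply] at hx
  simp only [repFun, hx]

theorem eLpNorm_repFun (g : Sim2) {φ : ℂ → ℂ} (hφ : AEStronglyMeasurable φ volume) :
    eLpNorm (repFun g φ) 2 volume = eLpNorm φ 2 volume := by
  have hw : 0 < ‖g.w‖ := norm_pos_iff.mpr g.w_ne
  have h1 : eLpNorm (repFun g φ) 2 volume
      = eLpNorm ((‖g.w‖ : ℂ) • fun x => φ (conj g.w * x)) 2 volume := by
    refine eLpNorm_congr_norm_ae (Filter.Eventually.of_forall fun x => ?_)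
    have : ‖Complex.exp (-(Complex.I * (inner ℝ g.b x : ℝ)))‖ = 1 := by
      rw [Complex.norm_exp]; simp
    simp only [repFun, norm_mul, this, Pi.smul_apply, smul_eq_mul, mul_one]
  rw [h1, eLpNorm_const_smul]
  have h2 : eLpNorm (fun x => φ (conj g.w * x)) 2 volume
      = eLpNorm φ 2 (Measure.map (fun x : ℂ => conj g.w * x) volume) := by
    rw [eLpNorm_map_measure _ (by fun_prop)]
    · rfl
    · rw [map_conj_mul]; exact hφ.smul_measure _
  rw [h2, map_conj_mul, eLpNorm_smul_measure_of_ne_top (by simp), smul_eq_mul, ← mul_assoc]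
  have h3 : ‖(‖g.w‖ : ℂ)‖ₑ * ENNReal.ofReal ((‖g.w‖ ^ 2)⁻¹) ^ (1 / (2 : ℝ≥0∞)).toReal = 1 := by
    rw [← ofReal_norm, ENNReal.ofReal_rpow_of_nonneg (by positivity) (by simp),
      ← ENNReal.ofReal_mul (by positivity)]
    have : (1 / (2 : ℝ≥0∞)).toReal = 1 / 2 := by simp
    rw [this, ← Real.sqrt_eq_rpow, Real.sqrt_inv, Real.sqrt_sq hw.le]
    simp [hw.ne']
  rw [h3, one_mul]

theorem memLp_repFun (g : Sim2) (φ : L2Plane) : MemLp (repFun g φ) 2 volume := by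
  refine ⟨?_, ?_⟩
  · have h : AEStronglyMeasurable (fun x => φ (conj g.w * x)) volume :=
      (Lp.aestronglyMeasurable φ).comp_quasiMeasurePreserving (quasi_conj_mul g)
    refine AEStronglyMeasurable.mul (Continuous.aestronglyMeasurable ?_) h
    fun_prop
  · rw [eLpNorm_repFun g (Lp.aestronglyMeasurable φ)]
    exact Lp.eLpNorm_lt_top φ

/-- `π(g)` as an isometry of `L²(ℝ²)`. -/
def repIso (g : Sim2) : L2Plane →ₗᵢ[ℂ] L2Plane where
  toFun φ := (memLp_repFun g φ).toLp
  map_add' φ ψ := by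
    rw [← MemLp.toLp_add]
    refine (MemLp.toLp_eq_toLp_iff _ _).mpr
      ((repFun_congr g (Lp.coeFn_add φ ψ)).trans (Filter.Eventually.of_forall fun x => ?_))
    simp [repFun, mul_add]
  map_smul' c φ := by
    rw [RingHom.id_apply, ← MemLp.toLp_const_smul]
    refine (MemLp.toLp_eq_toLp_iff _ _).mpr
      ((repFun_congr g (Lp.coeFn_smul c φ)).trans (Filter.Eventually.of_forall fun x => ?_))
    simp only [repFun, Pi.smul_apply, smul_eq_mul]
    ring
  norm_map' φ := by
    change ‖(memLp_repFun g φ).toLp‖ = ‖φ‖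
    rw [Lp.norm_toLp, eLpNorm_repFun g (Lp.aestronglyMeasurable φ), Lp.norm_def]

theorem repIso_ae (g : Sim2) (φ : L2Plane) : repIso g φ =ᵐ[volume] repFun g φ :=
  (memLp_repFun g φ).coeFn_toLp

/-- The representation `π` of `SIM(2)` on `L²(ℝ²)`, a homomorphism into the isometries. Its values are
invertible, as `SIM(2)` is a group, hence unitary. -/
def rep : Sim2 →* (L2Plane →ₗᵢ[ℂ] L2Plane) where
  toFun := repIso
  map_one' := by
    ext1 φ
    refine Lp.ext ((repIso_ae 1 φ).trans (Filter.Eventually.of_forall fun x => ?_))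
    simp [repFun]
  map_mul' g h := by
    ext1 φ
    refine Lp.ext ((repIso_ae (g * h) φ).trans (Filter.EventuallyEq.trans ?_
      ((repFun_congr g (repIso_ae h φ)).symm.trans (repIso_ae g (repIso h φ)).symm)))
    refine Filter.Eventually.of_forall fun x => ?_
    have h1 : (inner ℝ (g.b + g.w * h.b) x : ℝ)
        = inner ℝ g.b x + inner ℝ h.b (conj g.w * x) := by
      simp only [Complex.inner, map_add, map_mul]
      rw [← Complex.add_re]
      congr 1
      ring
    simp only [repFun, mul_b, mul_w, h1, norm_mul, map_mul]
    push_cast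
    rw [mul_add, neg_add, Complex.exp_add,
      show conj g.w * conj h.w * x = conj h.w * (conj g.w * x) by ring]
    ring

/-- The power `K ^ s` of the Duflo–Moore operator `(K φ)(x) = ‖x‖² φ(x)`, i.e. the operator of
multiplication by `‖x‖ ^ (2 s)`, with its maximal domain in `L²(ℝ²)`. -/
def dufloMoore (s : ℝ) : L2Plane →ₗ.[ℂ] L2Plane where
  domain :=
    { carrier := {φ | MemLp (fun x => ((‖x‖ ^ (2 * s) : ℝ) : ℂ) * φ x) 2 volume}
      add_mem' := fun {φ ψ} hφ hψ => (memLp_congr_ae (by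
        filter_upwards [Lp.coeFn_add φ ψ] with x hx
        simp only [hx, Pi.add_apply, mul_add])).mpr (hφ.add hψ)
      zero_mem' := (memLp_congr_ae (by
        filter_upwards [Lp.coeFn_zero ℂ 2 (volume : Measure ℂ)] with x hx
        rw [hx]
        simp)).mpr (MemLp.zero (ε := ℂ))
      smul_mem' := fun c φ hφ => (memLp_congr_ae (by
        filter_upwards [Lp.coeFn_smul c φ] with x hx
        simp only [hx, Pi.smul_apply, smul_eq_mul]
        ring)).mpr (hφ.const_mul c) }
  toFun :=
    { toFun := fun φ => MemLp.toLp (fun x => ((‖x‖ ^ (2 * s) : ℝ) : ℂ) * (φ : L2Plane) x) φ.2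
      map_add' := fun φ ψ => by
        rw [← MemLp.toLp_add]
        refine (MemLp.toLp_eq_toLp_iff _ _).mpr ?_
        filter_upwards [Lp.coeFn_add (φ : L2Plane) ψ] with x hx
        simp only [Submodule.coe_add, hx, Pi.add_apply, mul_add]
      map_smul' := fun c φ => by
        rw [RingHom.id_apply, ← MemLp.toLp_const_smul]
        refine (MemLp.toLp_eq_toLp_iff _ _).mpr ?_
        filter_upwards [Lp.coeFn_smul c (φ : L2Plane)] with x hx
        simp only [Submodule.coe_smul, hx, Pi.smul_apply, smul_eq_mul]
        ring }

/-! ### Symbols, the Wigner transform and the Weyl transform -/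

/-- `σ ∈ L^p(G × Ĝ, S_p)` for `Ĝ = {π}`: `σ` is a (weakly) measurable function with values in `S_p`
such that `∫ ‖σ(x, π) K^{1/p}‖_{S_p} ^ p dμ(x) < ∞`. -/
def MemLpSymbol (p : ℝ) (σ : Sim2 → L2Plane →L[ℂ] L2Plane) : Prop :=
  (∀ φ ψ : L2Plane, Measurable fun x => inner ℂ ψ (σ x φ)) ∧
  (∀ x, schattenPow p (σ x) < ∞) ∧
  ∫⁻ x, schattenPowPMap p ((σ x).toLinearMap.compPMap (dufloMoore (1 / p))) ∂haar < ∞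

/-- `B = W(f, g)(x, π) = ∫ f(x') g(x'⁻¹ x) π(x') dμ(x')`, the integral taken in the weak sense. -/
def IsWigner (f g : Sim2 → ℂ) (x : Sim2) (B : L2Plane →L[ℂ] L2Plane) : Prop :=
  ∀ φ ψ : L2Plane, inner ℂ ψ (B φ) = ∫ y, f y * g (y⁻¹ * x) * inner ℂ ψ (rep y φ) ∂haar

open Classical in
/-- The Wigner transform `W(f, g)(x, π)`, the unique bounded operator satisfying `IsWigner`. -/
def wigner (f g : Sim2 → ℂ) (x : Sim2) : L2Plane →L[ℂ] L2Plane :=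
  if h : ∃ B, IsWigner f g x B then h.choose else 0

/-- The densely defined operator `σ(x, π)* W(f, g)(x, π) K`. -/
def weylIntegrand (σ : Sim2 → L2Plane →L[ℂ] L2Plane) (f g : Sim2 → ℂ) (x : Sim2) :
    L2Plane →ₗ.[ℂ] L2Plane :=
  (star (σ x) * wigner f g x).toLinearMap.compPMap (dufloMoore 1)

/-- The pairing `⟨W(f, g), σ⟩_μ` is well defined: the traces exist and are integrable. -/
def WeylPairingExists (σ : Sim2 → L2Plane →L[ℂ] L2Plane) (f g : Sim2 → ℂ) : Prop :=
  (∀ᵐ x ∂haar, ∃ t, HasTrace (weylIntegrand σ f g x) t) ∧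
  Integrable (fun x => opTrace (weylIntegrand σ f g x)) haar

/-- The pairing `⟨W(f, g), σ⟩_μ = ∫ Tr (σ(x, π)* W(f, g)(x, π) K) dμ(x)`. -/
def weylPairing (σ : Sim2 → L2Plane →L[ℂ] L2Plane) (f g : Sim2 → ℂ) : ℂ :=
  ∫ x, opTrace (weylIntegrand σ f g x) ∂haar

/-- The Weyl transform `W_σ`, determined by `⟨W_σ f, conj g⟩ = ⟨W(f, g), σ⟩_μ` for test functions
`f`, `g`, is (the restriction of) a bounded linear operator on `L²(SIM(2))`. -/
def WeylIsBounded (σ : Sim2 → L2Plane →L[ℂ] L2Plane) : Prop :=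
  ∃ T : Lp ℂ 2 haar →L[ℂ] Lp ℂ 2 haar, ∀ (f g : Sim2 → ℂ) (hf : IsTest f), IsTest g →
    ∫ x, T (hf.memLp.toLp f) x * g x ∂haar = weylPairing σ f g

end Sim2

end

/-! A weight on the group can lie in `L^p` for a given p > 2 without lying in `L^2`; the symbol
turns such a weight into an unbounded Weyl transform. Take σ(x) = s(x)|u⟩⟨v|, where u and v are the
indicators of the discs of radius 1 and 2, and s(b, w) = (1 + ‖b‖²)^(-α/2) on the strip ‖w - 1‖ ≤
1/2, with 2/p < α < 1.

The operator σ(x)K^(1/p) extends to s(x)|u⟩⟨K^(1/p)v|, so its Schatten norm is a constant times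
s(x). The p-th power of s is integrable because αp exceeds 2, the dimension of the plane
(`memLpSymbol_weightedSymbol`).

The semi-invariance relation moves K across π(y) at the cost of a factor ‖w‖². Hence σ(x)*W(f,
g)(x)K is a bounded rank one operator with trace s(x)((f · `coef`) ∗ g)(x), where `coef` y =
‖w‖²⟨Ku, π(y)v⟩ (`hasTrace_weylIntegrand_rankOne`). The real part of `coef` has a positive lower
bound near the identity (`coef_re_ge`).

Fix a bump f near the identity and let g be a bump of width r in b. The convolution is bounded below
on a box of measure of order r², where s is at least of order r^(-α), so the pairing is at least c
r^(2-α) (`exists_pairing_lower_bound`). A bounded W_σ would bound it by ‖W_σ f‖‖g‖ = O(r)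
(`norm_toLp_le`), which fails as r → ∞ because α < 1. -/

noncomputable section

/-! ### Schatten powers and traces of rank one operators -/

section RankOne

variable {H : Type*} [NormedAddCommGroup H] [InnerProductSpace ℂ H]

open InnerProductSpace
open scoped NNReal

/-- This is Bessel's inequality for z. -/
theorem posTrace_smul_rankOne_le (c : ℝ≥0) (z : H) :
    posTrace (c • rankOne ℂ z z) ≤ ENNReal.ofReal (c * ‖z‖ ^ 2) := by
  refine iSup₂_le fun s hs => ?_
  have h1 : ∀ e ∈ s, ENNReal.ofReal (inner ℂ e ((c • rankOne ℂ z z) e)).re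
      = ENNReal.ofReal (c * ‖inner ℂ e z‖ ^ 2) := by
    intro e _
    congr 1
    rw [NNReal.smul_def, smul_apply, rankOne_apply, inner_smul_right_eq_smul, inner_smul_right,
      ← inner_conj_symm z e, Complex.conj_mul', Complex.real_smul, ← Complex.ofReal_pow,
      ← Complex.ofReal_mul, Complex.ofReal_re]
  rw [Finset.sum_congr rfl h1, ← ENNReal.ofReal_sum_of_nonneg fun _ _ => by positivity,
    ← Finset.mul_sum]
  refine ENNReal.ofReal_le_ofReal (mul_le_mul_of_nonneg_left ?_ c.2)
  have := hs.sum_inner_products_le z (s := Finset.univ)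
  rwa [Finset.sum_coe_sort s fun e => ‖inner ℂ e z‖ ^ 2] at this

variable [CompleteSpace H]

/-- The powers of a positive operator with `a * a = c • a`. -/
theorem rpow_of_mul_self_eq_smul {a : H →L[ℂ] H} (ha : 0 ≤ a) {c : ℝ≥0} (h : a * a = c • a)
    {y : ℝ} (hy : 0 < y) : a ^ y = c ^ (y - 1) • a := by
  -- The quadratic relation confines the spectrum to {0, c}, where t^y and c^(y-1) t agree; at t = 0
  -- this needs y > 0.
  have hsp : ∀ t ∈ spectrum ℝ≥0 a, t * t = c * t := by
    have h1 : cfc (fun t : ℝ≥0 => t * t) a = cfc (fun t : ℝ≥0 => c * t) a := by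
      rw [cfc_mul (fun t : ℝ≥0 => t) (fun t : ℝ≥0 => t) a, cfc_id' ℝ≥0 a,
        cfc_const_mul c (fun t : ℝ≥0 => t) a, cfc_id' ℝ≥0 a, h]
    exact eqOn_of_cfc_eq_cfc h1
  rw [CFC.rpow_def]
  have h2 : cfc (fun t : ℝ≥0 => t ^ y) a = cfc (fun t : ℝ≥0 => c ^ (y - 1) * t) a := by
    refine cfc_congr fun t ht => ?_
    rcases eq_or_ne t 0 with rfl | h0
    · simp [hy.ne']
    · have : t = c := mul_right_cancel₀ h0 (hsp t ht)
      subst this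
      rw [NNReal.rpow_sub_one h0, div_mul_cancel₀ _ h0]
  rw [h2, cfc_const_mul (c ^ (y - 1)) (fun t : ℝ≥0 => t) a, cfc_id' ℝ≥0 a]

/-- With A = |u⟩⟨z|, A*A = ‖u‖²|z⟩⟨z| squares to (‖u‖‖z‖)² times itself, so its powers are explicit
multiples of |z⟩⟨z|. -/
theorem schattenPow_rankOne_le {r : ℝ} (hr : 0 < r) (u z : H) :
    schattenPow r (rankOne ℂ u z) ≤ ENNReal.ofReal ((‖u‖ * ‖z‖) ^ r) := by
  have h1 : star (rankOne ℂ u z) * rankOne ℂ u z = (‖u‖₊ ^ 2) • rankOne ℂ z z := by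
    ext φ
    rw [ContinuousLinearMap.star_eq_adjoint, adjoint_rankOne, mul_apply_eq_comp,
      NNReal.smul_def, smul_apply, rankOne_apply, rankOne_apply, rankOne_apply, inner_smul_right,
      inner_self_eq_norm_sq_to_K, mul_comm, mul_smul, ← Complex.coe_smul]
    simp
  have h2 : (0 : H →L[ℂ] H) ≤ star (rankOne ℂ u z) * rankOne ℂ u z := star_mul_self_nonneg _
  have h3 : (star (rankOne ℂ u z) * rankOne ℂ u z) * (star (rankOne ℂ u z) * rankOne ℂ u z)
      = ((‖u‖₊ * ‖z‖₊) ^ 2) • (star (rankOne ℂ u z) * rankOne ℂ u z) := by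
    rw [h1, smul_mul_smul_comm, ContinuousLinearMap.mul_def, rankOne_comp_rankOne,
      inner_self_eq_norm_sq_to_K, smul_smul, mul_pow]
    have : (((‖z‖ : ℝ) : ℂ) ^ 2) • rankOne ℂ z z = (‖z‖₊ ^ 2) • rankOne ℂ z z := by
      rw [← Complex.ofReal_pow, Complex.coe_smul, NNReal.smul_def]
      simp
    rw [show ((RCLike.ofReal ‖z‖ : ℂ)) = ((‖z‖ : ℝ) : ℂ) from rfl, this, smul_smul]
    congr 1
    ring
  rw [schattenPow, rpow_of_mul_self_eq_smul h2 h3 (half_pos hr), h1, smul_smul]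
  refine (posTrace_smul_rankOne_le _ z).trans (le_of_eq ?_)
  congr 1
  push_cast
  rw [mul_assoc, ← mul_pow]
  rcases (mul_nonneg (norm_nonneg u) (norm_nonneg z)).eq_or_lt with h0 | h0
  · simp [← h0, hr.ne']
  · rw [Real.rpow_sub_one (by positivity), div_mul_cancel₀ _ (by positivity),
      ← Real.rpow_natCast, ← Real.rpow_mul h0.le]
    congr 1
    push_cast
    ring

/-- Bounded extensions agree on the dense domain, and some Hilbert basis exists to evaluate the
series. Thus the choice made in `opTrace` is immaterial. -/
theorem HasTrace.unique {T : H →ₗ.[ℂ] H} (hT : Dense (T.domain : Set H)) {t t' : ℂ}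
    (h : HasTrace T t) (h' : HasTrace T t') : t = t' := by
  obtain ⟨A, hA, hs⟩ := h
  obtain ⟨A', hA', hs'⟩ := h'
  have hAA : A = A' := by
    refine ContinuousLinearMap.coeFn_injective (Continuous.ext_on hT A.continuous A'.continuous ?_)
    intro φ hφ
    exact (hA ⟨φ, hφ⟩).trans (hA' ⟨φ, hφ⟩).symm
  subst hAA
  obtain ⟨v, e, -⟩ := exists_hilbertBasis ℂ H
  exact (hs v e).unique (hs' v e)

theorem HasTrace.opTrace_eq {T : H →ₗ.[ℂ] H} (hT : Dense (T.domain : Set H)) {t : ℂ}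
    (h : HasTrace T t) : opTrace T = t := by
  have hex : ∃ t, HasTrace T t := ⟨t, h⟩
  rw [opTrace, dif_pos hex]
  exact hex.choose_spec.unique hT h

/-- An operator `φ ↦ ℓ φ • v` with `ℓ` bounded has trace `ℓ v`. -/
theorem hasTrace_of_rankOne {T : H →ₗ.[ℂ] H} (ℓ : H →L[ℂ] ℂ) (v : H)
    (h : ∀ φ : T.domain, T φ = ℓ φ • v) : HasTrace T (ℓ v) := by
  refine ⟨ℓ.smulRight v, fun φ => by simp [h φ], fun ι e => ?_⟩
  -- By Riesz ℓ = ⟨z, ·⟩, and the diagonal series is Parseval's expansion of ⟨z, v⟩.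
  obtain ⟨z, rfl⟩ := (toDual ℂ H).surjective ℓ
  simpa [inner_smul_right] using e.hasSum_inner_mul_inner z v

end RankOne

/-! ### Measurability and the Haar measure in product coordinates -/

namespace Sim2

theorem measurable_coord : Measurable coord := comap_measurable coord

theorem measurable_w : Measurable w := measurable_snd.comp measurable_coord

theorem measurable_b : Measurable b := measurable_fst.comp measurable_coord

theorem measurable_inv_mul : Measurable fun q : Sim2 × Sim2 => q.2⁻¹ * q.1 := by
  refine measurable_comap_iff.mpr ?_
  have hb1 : Measurable fun q : Sim2 × Sim2 => q.1.b := measurable_b.comp measurable_fst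
  have hb2 : Measurable fun q : Sim2 × Sim2 => q.2.b := measurable_b.comp measurable_snd
  have hw1 : Measurable fun q : Sim2 × Sim2 => q.1.w := measurable_w.comp measurable_fst
  have hw2 : Measurable fun q : Sim2 × Sim2 => q.2.w := measurable_w.comp measurable_snd
  exact (((hw2.inv.mul hb2).neg).add (hw2.inv.mul hb1)).prodMk (hw2.inv.mul hw1)

/-- The measure `dw / |w|⁴` on the dilations and rotations. -/
def dilationMeasure : Measure ℂ := volume.withDensity fun w => ENNReal.ofReal ((‖w‖ ^ 4)⁻¹)

instance : SFinite dilationMeasure := by unfold dilationMeasure; infer_instance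

theorem map_coord_haar_eq_prod : haar.map coord = volume.prod dilationMeasure := by
  rw [map_coord_haar, dilationMeasure, prod_withDensity_right (by fun_prop), Measure.volume_eq_prod]

/-- S-finiteness passes through a measurable embedding. It makes integrals over the group measurable
in a parameter. -/
instance : SFinite haar := by
  have h2 : SFinite ((haar.map coord).comap coord) := by
    rw [map_coord_haar_eq_prod]
    refine ⟨fun n => (sfiniteSeq (volume.prod dilationMeasure) n).comap coord, fun n => ?_, ?_⟩
    · refine ⟨?_⟩
      rw [measurableEmbedding_coord.comap_apply]
      exact measure_lt_top _ _
    · ext s hs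
      rw [measurableEmbedding_coord.comap_apply, Measure.sum_apply _ hs]
      simp_rw [measurableEmbedding_coord.comap_apply]
      rw [← Measure.sum_apply _ (measurableEmbedding_coord.measurableSet_image.mpr hs),
        sum_sfiniteSeq]
  rwa [measurableEmbedding_coord.comap_map] at h2

theorem lintegral_haar (F : ℂ × ℂ → ℝ≥0∞) :
    ∫⁻ y, F y.coord ∂haar = ∫⁻ z, F z ∂(volume.prod dilationMeasure) := by
  rw [← map_coord_haar_eq_prod, measurableEmbedding_coord.lintegral_map]

/-- The product of a set of translations and a set of dilations and rotations. -/
def box (A B : Set ℂ) : Set Sim2 := {y | y.b ∈ A ∧ y.w ∈ B}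

theorem measurableSet_box {A B : Set ℂ} (hA : MeasurableSet A) (hB : MeasurableSet B) :
    MeasurableSet (box A B) :=
  (measurable_b hA).inter (measurable_w hB)

theorem haar_box (A B : Set ℂ) : haar (box A B) = volume A * dilationMeasure B := by
  rw [← Measure.prod_prod, ← map_coord_haar_eq_prod, measurableEmbedding_coord.map_apply]
  rfl

theorem dilationMeasure_lt_top {B : Set ℂ} (hB : MeasurableSet B) {r R : ℝ} (hr : 0 < r)
    (h : ∀ w ∈ B, r ≤ ‖w‖ ∧ ‖w‖ ≤ R) : dilationMeasure B < ∞ := by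
  rw [dilationMeasure, withDensity_apply _ hB]
  calc ∫⁻ w in B, ENNReal.ofReal ((‖w‖ ^ 4)⁻¹) ≤ ∫⁻ _ in B, ENNReal.ofReal ((r ^ 4)⁻¹) := by
        refine setLIntegral_mono measurable_const fun w hw => ENNReal.ofReal_le_ofReal ?_
        have := (h w hw).1
        gcongr
    _ < ∞ := by
        rw [setLIntegral_const]
        refine ENNReal.mul_lt_top ENNReal.ofReal_lt_top ?_
        refine (measure_mono fun w hw => ?_).trans_lt
          (isCompact_closedBall (0 : ℂ) R).measure_lt_top
        simpa using (h w hw).2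

theorem dilationMeasure_closedBall_lt_top {r : ℝ} (hr : r < 1) :
    dilationMeasure (Metric.closedBall 1 r) < ∞ := by
  refine dilationMeasure_lt_top (r := 1 - r) (R := 1 + r) Metric.isClosed_closedBall.measurableSet
    (by linarith) fun w hw => ?_
  rw [mem_closedBall_iff_norm] at hw
  have h1 := norm_sub_norm_le 1 w
  have h2 := norm_sub_norm_le w 1
  rw [norm_sub_rev, norm_one] at h1
  rw [norm_one] at h2
  constructor <;> linarith

theorem dilationMeasure_closedBall_pos {r : ℝ} (hr : 0 < r) :
    0 < dilationMeasure (Metric.closedBall 1 r) := by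
  have hm : MeasurableSet (Metric.closedBall (1 : ℂ) r) := Metric.isClosed_closedBall.measurableSet
  rw [dilationMeasure, withDensity_apply _ hm]
  refine setLIntegral_pos_iff (by fun_prop) |>.mpr ?_
  -- The origin, where the density is 0 by the convention 0⁻¹ = 0, may lie in the ball; it is a null
  -- set and is removed.
  have hsub : Metric.closedBall (1 : ℂ) r \ {0}
      ⊆ Function.support (fun w : ℂ => ENNReal.ofReal ((‖w‖ ^ 4)⁻¹)) ∩ Metric.closedBall 1 r := by
    rintro w ⟨hw, h0⟩
    refine ⟨?_, hw⟩
    have : 0 < ‖w‖ := norm_pos_iff.mpr h0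
    simpa using by positivity
  refine lt_of_lt_of_le ?_ (measure_mono hsub)
  rw [measure_sdiff_null (by simp)]
  exact Metric.measure_closedBall_pos _ _ hr

/-! ### Test functions -/

theorem IsTest.measurable {f : Sim2 → ℂ} (hf : IsTest f) : Measurable f := by
  obtain ⟨F, hF, -, -, hfF⟩ := hf
  rw [show f = F ∘ coord from funext hfF]
  exact hF.continuous.measurable.comp measurable_coord

theorem IsTest.exists_bound {f : Sim2 → ℂ} (hf : IsTest f) : ∃ C, 0 ≤ C ∧ ∀ y, ‖f y‖ ≤ C := by
  obtain ⟨F, hF, hc, -, hfF⟩ := hf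
  obtain ⟨C, hC⟩ := hc.exists_bound_of_continuous hF.continuous
  exact ⟨C, (norm_nonneg _).trans (hC 0), fun y => hfF y ▸ hC _⟩

/-- The lower bound on ‖w‖ holds because ‖w‖⁻¹ is continuous on the compact support, which avoids w
= 0. -/
theorem IsTest.exists_support_bound {f : Sim2 → ℂ} (hf : IsTest f) :
    ∃ R, 0 < R ∧ ∀ y, f y ≠ 0 → ‖y.b‖ ≤ R ∧ R⁻¹ ≤ ‖y.w‖ ∧ ‖y.w‖ ≤ R := by
  obtain ⟨F, hF, hc, hs, hfF⟩ := hf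
  have hcont : ContinuousOn (fun z : ℂ × ℂ => ‖z.2‖⁻¹) (tsupport F) :=
    ContinuousOn.inv₀ (by fun_prop) fun z hz => norm_ne_zero_iff.mpr (hs hz)
  obtain ⟨D, hD⟩ := hc.isCompact.exists_bound_of_continuousOn hcont
  obtain ⟨E, hE⟩ := hc.isCompact.exists_bound_of_continuousOn
    (f := fun z : ℂ × ℂ => z) continuousOn_id
  refine ⟨max 1 (max D E), by positivity, fun y hy => ?_⟩
  have hmem : y.coord ∈ tsupport F := subset_tsupport F (by rwa [Function.mem_support, ← hfF])
  have h1 := hD _ hmem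
  have h2 := hE _ hmem
  rw [norm_inv, norm_norm] at h1
  have h3 : D ≤ max 1 (max D E) := (le_max_left D E).trans (le_max_right _ _)
  have h4 : E ≤ max 1 (max D E) := (le_max_right D E).trans (le_max_right _ _)
  refine ⟨(norm_fst_le y.coord).trans (h2.trans h4), ?_, (norm_snd_le y.coord).trans (h2.trans h4)⟩
  rw [inv_le_comm₀ (by positivity) (norm_pos_iff.mpr y.w_ne)]
  exact h1.trans h3

theorem IsTest.integrable {f : Sim2 → ℂ} (hf : IsTest f) : Integrable f haar := by
  obtain ⟨C, -, hC⟩ := hf.exists_bound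
  obtain ⟨R, hR, hs⟩ := hf.exists_support_bound
  have hB : MeasurableSet {w : ℂ | R⁻¹ ≤ ‖w‖ ∧ ‖w‖ ≤ R} :=
    (measurableSet_le measurable_const measurable_norm).inter
      (measurableSet_le measurable_norm measurable_const)
  have hA : MeasurableSet (Metric.closedBall (0 : ℂ) R) := Metric.isClosed_closedBall.measurableSet
  have hfin : haar (box (Metric.closedBall 0 R) {w : ℂ | R⁻¹ ≤ ‖w‖ ∧ ‖w‖ ≤ R}) < ∞ := by
    rw [haar_box]
    exact ENNReal.mul_lt_top measure_closedBall_lt_top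
      (dilationMeasure_lt_top hB (inv_pos.mpr hR) fun w hw => hw)
  have hi := Measure.integrableOn_of_bounded hfin.ne hf.measurable.aestronglyMeasurable
    (Filter.Eventually.of_forall hC)
  rw [← integrable_indicator_iff (measurableSet_box hA hB)] at hi
  rwa [Set.indicator_eq_self.mpr] at hi
  intro y hy
  exact ⟨by simpa using (hs y hy).1, (hs y hy).2⟩

end Sim2

namespace Sim2

/-! ### Matrix coefficients of the representation -/

theorem inner_rep_eq_integral (φ ψ : L2Plane) (y : Sim2) :
    inner ℂ ψ (rep y φ) = ∫ ξ, repFun y φ ξ * conj (ψ ξ) := by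
  rw [L2.inner_def]
  refine integral_congr_ae ?_
  filter_upwards [repIso_ae y φ] with ξ hξ
  rw [← hξ, RCLike.inner_apply]
  rfl

/-- No continuity of π is needed: the coefficient is a parameter integral of a jointly measurable
function. -/
theorem stronglyMeasurable_inner_rep (φ ψ : L2Plane) :
    StronglyMeasurable fun y : Sim2 => inner ℂ ψ (rep y φ) := by
  simp_rw [inner_rep_eq_integral]
  have hφ : Measurable φ := (Lp.stronglyMeasurable φ).measurable
  have hψ : Measurable ψ := (Lp.stronglyMeasurable ψ).measurable
  have hb : Measurable fun q : Sim2 × ℂ => q.1.b := measurable_b.comp measurable_fst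
  have hw : Measurable fun q : Sim2 × ℂ => q.1.w := measurable_w.comp measurable_fst
  have h2 : Measurable fun q : Sim2 × ℂ => q.2 := measurable_snd
  have hc : Measurable fun q : Sim2 × ℂ => conj q.1.w := Complex.continuous_conj.measurable.comp hw
  have hc2 : Measurable fun q : Sim2 × ℂ => conj (ψ q.2) :=
    Complex.continuous_conj.measurable.comp (hψ.comp h2)
  have hin : Measurable fun q : Sim2 × ℂ => (inner ℝ q.1.b q.2 : ℝ) := hb.inner h2
  have hm : Measurable fun q : Sim2 × ℂ => repFun q.1 φ q.2 * conj (ψ q.2) := by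
    unfold repFun
    have h3 : Measurable fun q : Sim2 × ℂ => φ (conj q.1.w * q.2) := hφ.comp (hc.mul h2)
    fun_prop
  exact hm.stronglyMeasurable.integral_prod_right

theorem norm_inner_rep_le (φ ψ : L2Plane) (y : Sim2) :
    ‖(inner ℂ ψ (rep y φ) : ℂ)‖ ≤ ‖ψ‖ * ‖φ‖ := by
  simpa using norm_inner_le_norm ψ (rep y φ)

theorem integrable_mul_inner_rep {h : Sim2 → ℂ} (hh : Integrable h haar) (φ ψ : L2Plane) :
    Integrable (fun y => h y * inner ℂ ψ (rep y φ)) haar :=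
  hh.mul_bdd (c := ‖ψ‖ * ‖φ‖) (stronglyMeasurable_inner_rep φ ψ).aestronglyMeasurable
    (Filter.Eventually.of_forall (norm_inner_rep_le φ ψ))

/-- The weak operator-valued integral `∫ h(y) π(y) dμ(y)` of an integrable function. -/
theorem exists_weakIntegral {h : Sim2 → ℂ} (hh : Integrable h haar) :
    ∃ B : L2Plane →L[ℂ] L2Plane, ∀ φ ψ : L2Plane,
      inner ℂ ψ (B φ) = ∫ y, h y * inner ℂ ψ (rep y φ) ∂haar := by
  let b : L2Plane →ₗ⋆[ℂ] L2Plane →ₗ[ℂ] ℂ := LinearMap.mk₂'ₛₗ (starRingEnd ℂ) (RingHom.id ℂ)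
    (fun ψ φ => ∫ y, h y * inner ℂ ψ (rep y φ) ∂haar)
    (fun ψ ψ' φ => by
      rw [← integral_add (integrable_mul_inner_rep hh φ ψ) (integrable_mul_inner_rep hh φ ψ')]
      simp_rw [inner_add_left, mul_add])
    (fun c ψ φ => by
      rw [smul_eq_mul, ← integral_const_mul]
      simp_rw [inner_smul_left, mul_left_comm])
    (fun ψ φ φ' => by
      rw [← integral_add (integrable_mul_inner_rep hh φ ψ) (integrable_mul_inner_rep hh φ' ψ)]
      simp_rw [map_add, inner_add_right, mul_add])
    (fun c ψ φ => by
      rw [RingHom.id_apply, smul_eq_mul, ← integral_const_mul]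
      simp_rw [map_smul, inner_smul_right, mul_left_comm])
  have hb : ∀ ψ φ, ‖b ψ φ‖ ≤ (∫ y, ‖h y‖ ∂haar) * ‖ψ‖ * ‖φ‖ := by
    intro ψ φ
    calc ‖b ψ φ‖ ≤ ∫ y, ‖h y‖ * (‖ψ‖ * ‖φ‖) ∂haar := by
          refine norm_integral_le_of_norm_le (hh.norm.mul_const _)
            (Filter.Eventually.of_forall fun y => ?_)
          rw [norm_mul]
          exact mul_le_mul_of_nonneg_left (norm_inner_rep_le φ ψ y) (norm_nonneg _)
      _ = _ := by rw [integral_mul_const, mul_assoc]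
  -- The form is bounded by the L¹ norm of h. Its representing operator acts on the conjugate-linear
  -- variable ψ; the adjoint moves it to φ.
  refine ⟨star (InnerProductSpace.continuousLinearMapOfBilin (b.mkContinuous₂ _ hb)), fun φ ψ => ?_⟩
  rw [ContinuousLinearMap.star_eq_adjoint, ContinuousLinearMap.adjoint_inner_right,
    InnerProductSpace.continuousLinearMapOfBilin_apply]
  rfl

theorem integrable_mul_translate {f g : Sim2 → ℂ} (hf : IsTest f) (hg : IsTest g) (x : Sim2) :
    Integrable (fun y => f y * g (y⁻¹ * x)) haar := by
  obtain ⟨C, -, hC⟩ := hg.exists_bound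
  refine hf.integrable.mul_bdd (c := C) ?_ (Filter.Eventually.of_forall fun y => hC _)
  exact (hg.measurable.comp
    (measurable_inv_mul.comp (measurable_prodMk_left (x := x)))).aestronglyMeasurable

/-- The factor ‖w‖², which comes from the semi-invariance of K, is bounded on the support of f. -/
theorem integrable_mul_translate_mul_norm_sq {f g : Sim2 → ℂ} (hf : IsTest f) (hg : IsTest g)
    (x : Sim2) : Integrable (fun y => f y * g (y⁻¹ * x) * (‖y.w‖ : ℂ) ^ 2) haar := by
  obtain ⟨R, hR, hs⟩ := hf.exists_support_bound
  refine ((integrable_mul_translate hf hg x).norm.mul_const (R ^ 2)).mono'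
    ((integrable_mul_translate hf hg x).aestronglyMeasurable.mul ?_)
    (Filter.Eventually.of_forall fun y => ?_)
  · have := measurable_w
    fun_prop
  · rcases eq_or_ne (f y) 0 with h0 | h0
    · simp [h0]
    · have := (hs y h0).2.2
      rw [norm_mul, norm_pow, Complex.norm_real, norm_norm]
      gcongr

theorem isWigner_wigner {f g : Sim2 → ℂ} (hf : IsTest f) (hg : IsTest g) (x : Sim2) :
    IsWigner f g x (wigner f g x) := by
  have h : ∃ B, IsWigner f g x B := exists_weakIntegral (integrable_mul_translate hf hg x)
  rw [wigner, dif_pos h]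
  exact h.choose_spec

/-! ### The Duflo–Moore operator -/

theorem dufloMoore_ae (s : ℝ) (φ : (dufloMoore s).domain) :
    dufloMoore s φ =ᵐ[volume] fun x => ((‖x‖ ^ (2 * s) : ℝ) : ℂ) * (φ : L2Plane) x :=
  MemLp.coeFn_toLp φ.2

theorem inner_dufloMoore_comm (s : ℝ) (u φ : (dufloMoore s).domain) :
    inner ℂ (u : L2Plane) (dufloMoore s φ) = inner ℂ (dufloMoore s u) (φ : L2Plane) := by
  rw [L2.inner_def, L2.inner_def]
  refine integral_congr_ae ?_
  filter_upwards [dufloMoore_ae s u, dufloMoore_ae s φ] with x h1 h2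
  rw [h1, h2, RCLike.inner_apply, RCLike.inner_apply, map_mul, Complex.conj_ofReal]
  ring

/-- The semi-invariance relation between `π` and `K`. -/
theorem inner_rep_dufloMoore (u φ : (dufloMoore 1).domain) (y : Sim2) :
    inner ℂ (u : L2Plane) (rep y (dufloMoore 1 φ))
      = (‖y.w‖ : ℂ) ^ 2 * inner ℂ (dufloMoore 1 u) (rep y (φ : L2Plane)) := by
  rw [inner_rep_eq_integral, inner_rep_eq_integral, ← integral_const_mul]
  refine integral_congr_ae ?_
  filter_upwards [dufloMoore_ae 1 u, repFun_congr y (dufloMoore_ae 1 φ)] with x h1 h2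
  rw [h1, h2, map_mul, Complex.conj_ofReal]
  simp only [repFun, norm_mul, RCLike.norm_conj, mul_one, Real.rpow_ofNat]
  push_cast
  ring

/-- A vector ψ orthogonal to the domain is tested against (1 + ‖x‖²)⁻¹ψ, which lies in the domain;
this forces ψ = 0. -/
theorem dense_domain_dufloMoore : Dense ((dufloMoore 1).domain : Set L2Plane) := by
  rw [Submodule.dense_iff_topologicalClosure_eq_top, Submodule.topologicalClosure_eq_top_iff,
    Submodule.eq_bot_iff]
  intro ψ hψ
  have hc : Continuous fun x : ℂ => (((1 + ‖x‖ ^ 2)⁻¹ : ℝ) : ℂ) :=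
    Complex.continuous_ofReal.comp (Continuous.inv₀ (by fun_prop) fun x => by positivity)
  have hm := hc.aestronglyMeasurable.mul (Lp.aestronglyMeasurable ψ) (μ := volume)
  have h1 : MemLp (fun x => (((1 + ‖x‖ ^ 2)⁻¹ : ℝ) : ℂ) * ψ x) 2 volume := by
    refine (Lp.memLp ψ).of_le hm (Filter.Eventually.of_forall fun x => ?_)
    rw [norm_mul, Complex.norm_real, Real.norm_of_nonneg (by positivity)]
    refine mul_le_of_le_one_left (norm_nonneg _) (inv_le_one_of_one_le₀ ?_)
    nlinarith [sq_nonneg ‖x‖]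
  have h2 : h1.toLp ∈ (dufloMoore 1).domain := by
    have hm' : AEStronglyMeasurable (fun x : ℂ => ((‖x‖ ^ (2 * (1 : ℝ)) : ℝ) : ℂ)) volume := by
      simp only [mul_one, Real.rpow_ofNat]
      fun_prop
    refine (Lp.memLp ψ).of_le (hm'.mul (Lp.aestronglyMeasurable _)) ?_
    filter_upwards [h1.coeFn_toLp] with x hx
    rw [hx, ← mul_assoc, norm_mul, ← Complex.ofReal_mul, Complex.norm_real,
      Real.norm_of_nonneg (by positivity), mul_one, Real.rpow_ofNat]
    refine mul_le_of_le_one_left (norm_nonneg _) ?_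
    rw [← div_eq_mul_inv, div_le_one (by positivity)]
    linarith
  have h3 := hψ _ h2
  rw [L2.inner_def] at h3
  have h4 : (fun x : ℂ => (inner ℂ ((h1.toLp : L2Plane) x) (ψ x) : ℂ))
      =ᵐ[volume] fun x : ℂ => (((1 + ‖x‖ ^ 2)⁻¹ * ‖ψ x‖ ^ 2 : ℝ) : ℂ) := by
    filter_upwards [h1.coeFn_toLp] with x hx
    rw [hx, RCLike.inner_apply, map_mul, Complex.conj_ofReal, mul_left_comm, Complex.mul_conj']
    push_cast
    ring
  have hint := (L2.integrable_inner (𝕜 := ℂ) h1.toLp ψ).congr h4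
  rw [integral_congr_ae h4, integral_complex_ofReal, Complex.ofReal_eq_zero,
    integral_eq_zero_iff_of_nonneg (fun x => by positivity)] at h3
  · refine (Lp.eq_zero_iff_ae_eq_zero).mpr ?_
    filter_upwards [h3] with x hx
    have h5 : (1 + ‖x‖ ^ 2)⁻¹ ≠ 0 := by positivity
    simpa [h5] using hx
  · exact hint.re

/-! ### Rank one symbols -/

open InnerProductSpace

/-- The adjoint symbol is s(x)|v⟩⟨u|, so only φ ↦ ⟨u, W K φ⟩ matters. Semi-invariance shifts the
unbounded K from φ to u, which leaves a bounded functional; its value at v is the trace. -/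
theorem hasTrace_weylIntegrand_rankOne (u : (dufloMoore 1).domain) (v : L2Plane) (s : Sim2 → ℝ)
    {f g : Sim2 → ℂ} (hf : IsTest f) (hg : IsTest g) (x : Sim2) :
    HasTrace (weylIntegrand (fun x => (s x : ℂ) • rankOne ℂ (u : L2Plane) v) f g x)
      (s x * ∫ y, f y * g (y⁻¹ * x) * (‖y.w‖ : ℂ) ^ 2
        * inner ℂ (dufloMoore 1 u) (rep y v) ∂haar) := by
  obtain ⟨B, hB⟩ := exists_weakIntegral (integrable_mul_translate_mul_norm_sq hf hg x)
  rw [← hB]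
  refine hasTrace_of_rankOne ((s x : ℂ) • (innerSL ℂ (dufloMoore 1 u)).comp B) v fun φ => ?_
  change star ((s x : ℂ) • rankOne ℂ (u : L2Plane) v) (wigner f g x (dufloMoore 1 φ)) = _
  rw [star_smul, ContinuousLinearMap.star_eq_adjoint, adjoint_rankOne, smul_apply, rankOne_apply,
    isWigner_wigner hf hg x, ← smul_assoc]
  congr 1
  change _ = (s x : ℂ) • inner ℂ (dufloMoore 1 u) (B φ)
  rw [hB, Complex.star_def, Complex.conj_ofReal]
  congr 2
  ext y
  exact (congrArg (f y * g (y⁻¹ * x) * ·) (inner_rep_dufloMoore u φ y)).trans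
    (mul_assoc _ _ _).symm

end Sim2

theorem MeasureTheory.mul_measureReal_le_integral {X : Type*} [MeasurableSpace X] {μ : Measure X}
    {F : X → ℝ} (hF : Integrable F μ) (h0 : ∀ x, 0 ≤ F x) {S : Set X} (hS : MeasurableSet S)
    (hfin : μ S ≠ ∞) {c : ℝ} (hc : ∀ x ∈ S, c ≤ F x) : c * μ.real S ≤ ∫ x, F x ∂μ := by
  rw [mul_comm, ← smul_eq_mul, ← setIntegral_const]
  exact (setIntegral_mono_on (integrableOn_const hfin) hF.integrableOn hS hc).trans
    (setIntegral_le_integral hF (Filter.Eventually.of_forall h0))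

namespace Sim2

open InnerProductSpace Metric

/-! ### Indicator functions of balls in the representation space -/

/-- The indicator function of the ball of radius `r`. -/
def ballVec (r : ℝ) : L2Plane :=
  indicatorConstLp 2 (isClosed_closedBall (x := (0 : ℂ)) (ε := r)).measurableSet
    measure_closedBall_lt_top.ne (1 : ℂ)

theorem ballVec_ae (r : ℝ) :
    ballVec r =ᵐ[volume] (closedBall (0 : ℂ) r).indicator fun _ => (1 : ℂ) :=
  indicatorConstLp_coeFn

theorem ballVec_mem_domain (r : ℝ) {s : ℝ} (hs : 0 ≤ s) : ballVec r ∈ (dufloMoore s).domain := by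
  have hc : Continuous fun x : ℂ => ((‖x‖ ^ (2 * s) : ℝ) : ℂ) :=
    Complex.continuous_ofReal.comp
      (continuous_norm.rpow_const fun _ => Or.inr (mul_nonneg zero_le_two hs))
  refine (Lp.memLp (ballVec r)).of_le_mul (c := r ^ (2 * s))
    (hc.aestronglyMeasurable.mul (Lp.aestronglyMeasurable _)) ?_
  filter_upwards [ballVec_ae r] with x hx
  rw [hx, norm_mul, Complex.norm_real, Real.norm_of_nonneg (by positivity)]
  by_cases h : x ∈ closedBall (0 : ℂ) r
  · refine mul_le_mul_of_nonneg_right ?_ (norm_nonneg _)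
    exact Real.rpow_le_rpow (norm_nonneg x) (by simpa using h) (by positivity)
  · simp [h]

/-- The ball vector as an element of the domain of `K ^ s`. -/
def ballDom (r s : ℝ) (hs : 0 ≤ s) : (dufloMoore s).domain := ⟨ballVec r, ballVec_mem_domain r hs⟩

/-- On the unit disc |⟨b, ξ⟩| ≤ 1, so the cosine is at least 1 - 1/2. -/
theorem re_setIntegral_ge {b : ℂ} (hb : ‖b‖ ≤ 1) :
    ∫ ξ in closedBall (0 : ℂ) 1, ‖ξ‖ ^ 2 / 2 ≤
      (∫ ξ in closedBall (0 : ℂ) 1,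
        (‖ξ‖ : ℂ) ^ 2 * Complex.exp (-(Complex.I * (inner ℝ b ξ : ℝ)))).re := by
  have hi : IntegrableOn (fun ξ : ℂ => (‖ξ‖ : ℂ) ^ 2 *
      Complex.exp (-(Complex.I * (inner ℝ b ξ : ℝ)))) (closedBall 0 1) :=
    ContinuousOn.integrableOn_compact (isCompact_closedBall _ _)
      (Continuous.continuousOn (by fun_prop))
  have hre : ∀ ξ : ℂ, ((‖ξ‖ : ℂ) ^ 2 * Complex.exp (-(Complex.I * (inner ℝ b ξ : ℝ)))).re
      = ‖ξ‖ ^ 2 * Real.cos (inner ℝ b ξ) := by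
    intro ξ
    rw [← Complex.ofReal_pow, Complex.re_ofReal_mul,
      show ∀ t : ℝ, -(Complex.I * t) = ((-t : ℝ) : ℂ) * Complex.I from fun t => by
        push_cast; ring, Complex.exp_ofReal_mul_I_re, Real.cos_neg]
  have h1 := integral_re hi
  simp only [RCLike.re_eq_complex_re] at h1
  rw [← h1]
  simp_rw [hre]
  refine setIntegral_mono_on ?_ ?_ isClosed_closedBall.measurableSet fun ξ hξ => ?_
  · exact ContinuousOn.integrableOn_compact (isCompact_closedBall _ _)
      (Continuous.continuousOn (by fun_prop))
  · exact ContinuousOn.integrableOn_compact (isCompact_closedBall _ _)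
      (Continuous.continuousOn (by fun_prop))
  · have h2 : |(inner ℝ b ξ : ℝ)| ≤ 1 := by
      refine (abs_real_inner_le_norm b ξ).trans ?_
      exact mul_le_one₀ hb (norm_nonneg _) (by simpa using hξ)
    have h3 := Real.one_sub_sq_div_two_le_cos (x := inner ℝ b ξ)
    have h4 : (inner ℝ b ξ : ℝ) ^ 2 ≤ 1 := (sq_le_one_iff_abs_le_one _).mpr h2
    rw [div_eq_mul_inv]
    exact mul_le_mul_of_nonneg_left (by rw [inv_eq_one_div]; linarith) (by positivity)

theorem setIntegral_norm_sq_pos : 0 < ∫ ξ in closedBall (0 : ℂ) 1, ‖ξ‖ ^ 2 / 2 := by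
  rw [setIntegral_pos_iff_support_of_nonneg_ae
    (Filter.Eventually.of_forall fun ξ => by positivity)
    (ContinuousOn.integrableOn_compact (isCompact_closedBall _ _)
      (Continuous.continuousOn (by fun_prop)))]
  refine lt_of_lt_of_le ?_ (measure_mono (s := closedBall (0 : ℂ) 1 \ {0}) ?_)
  · rw [measure_sdiff_null (by simp)]
    exact measure_closedBall_pos _ _ one_pos
  · rintro ξ ⟨h1, h2⟩
    refine ⟨?_, h1⟩
    simpa using h2

/-- The matrix coefficient which governs the Weyl transform of the rank one symbols below. -/
def coef (y : Sim2) : ℂ :=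
  (‖y.w‖ : ℂ) ^ 2 * inner ℂ (dufloMoore 1 (ballDom 1 1 zero_le_one)) (rep y (ballVec 2))

/-- The radius 2 in v is chosen for this: multiplication by the conjugate of w keeps the unit disc
inside the disc of radius 2, so v contributes the factor 1 on the support of u. The third power is
‖w‖² times the factor ‖w‖ in π. -/
theorem coef_eq {y : Sim2} (hw : ‖y.w‖ ≤ 2) :
    coef y = ((‖y.w‖ ^ 3 : ℝ) : ℂ) * ∫ ξ in closedBall (0 : ℂ) 1,
        (‖ξ‖ : ℂ) ^ 2 * Complex.exp (-(Complex.I * (inner ℝ y.b ξ : ℝ))) := by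
  rw [coef, inner_rep_eq_integral, ← integral_indicator isClosed_closedBall.measurableSet,
    ← integral_const_mul, ← integral_const_mul]
  refine integral_congr_ae ?_
  filter_upwards [dufloMoore_ae 1 (ballDom 1 1 zero_le_one), repFun_congr y (ballVec_ae 2),
    ballVec_ae 1] with ξ h1 h2 h3
  have h4 : ((ballDom 1 1 zero_le_one : (dufloMoore 1).domain) : L2Plane) ξ = ballVec 1 ξ := rfl
  rw [h1, h2, h4, h3]
  by_cases h : ξ ∈ closedBall (0 : ℂ) 1
  · have h5 : conj y.w * ξ ∈ closedBall (0 : ℂ) 2 := by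
      rw [mem_closedBall_zero_iff] at h ⊢
      rw [norm_mul, RCLike.norm_conj]
      nlinarith [norm_nonneg ξ, norm_nonneg y.w]
    simp only [repFun, Set.indicator_of_mem h, Set.indicator_of_mem h5, mul_one, Real.rpow_ofNat,
      Complex.conj_ofReal]
    push_cast
    ring
  · simp [h]

theorem coef_re_ge {y : Sim2} (hb : ‖y.b‖ ≤ 1) (hw : 1 / 2 ≤ ‖y.w‖) (hw' : ‖y.w‖ ≤ 2) :
    (∫ ξ in closedBall (0 : ℂ) 1, ‖ξ‖ ^ 2 / 2) / 8 ≤ (coef y).re := by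
  rw [coef_eq hw', Complex.re_ofReal_mul]
  have h1 := re_setIntegral_ge hb
  have h2 := setIntegral_norm_sq_pos
  have h3 : (1 / 8 : ℝ) ≤ ‖y.w‖ ^ 3 := by
    calc (1 / 8 : ℝ) = (1 / 2) ^ 3 := by norm_num
      _ ≤ _ := by gcongr
  nlinarith

/-! ### Test functions adapted to boxes -/

/-- A product of smooth bumps: only the width in b varies with r, while w stays in a fixed disc
around 1 that avoids 0. -/
theorem exists_isTest {r : ℝ} (hr : 0 < r) : ∃ f : Sim2 → ℝ, IsTest (fun y => (f y : ℂ)) ∧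
    (∀ y, 0 ≤ f y) ∧ (∀ y, f y ≤ 1) ∧
    (∀ y ∈ box (closedBall 0 r) (closedBall 1 (1 / 4)), f y = 1) ∧
    (∀ y, f y ≠ 0 → y ∈ box (closedBall 0 (2 * r)) (closedBall 1 (1 / 2))) := by
  let β : ContDiffBump (0 : ℂ) := ⟨r, 2 * r, hr, by linarith⟩
  let δ : ContDiffBump (1 : ℂ) := ⟨1 / 4, 1 / 2, by norm_num, by norm_num⟩
  have hβ : ∀ b, β b ≠ 0 → b ∈ closedBall (0 : ℂ) (2 * r) := fun b hb =>
    ball_subset_closedBall (β.support_eq ▸ (Function.mem_support.mpr hb))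
  have hδ : ∀ w, δ w ≠ 0 → w ∈ closedBall (1 : ℂ) (1 / 2) := fun w hw =>
    ball_subset_closedBall (δ.support_eq ▸ (Function.mem_support.mpr hw))
  have hsupp : Function.support (fun z : ℂ × ℂ => ((β z.1 * δ z.2 : ℝ) : ℂ))
      ⊆ closedBall 0 (2 * r) ×ˢ closedBall 1 (1 / 2) := by
    intro z hz
    rw [Function.mem_support, Complex.ofReal_ne_zero] at hz
    exact ⟨hβ _ (left_ne_zero_of_mul hz), hδ _ (right_ne_zero_of_mul hz)⟩
  refine ⟨fun y => β y.b * δ y.w, ⟨fun z => ((β z.1 * δ z.2 : ℝ) : ℂ), ?_, ?_, ?_, fun y => rfl⟩,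
    fun y => mul_nonneg β.nonneg δ.nonneg, fun y => mul_le_one₀ β.le_one δ.nonneg δ.le_one,
    fun y hy => ?_, fun y hy => ⟨hβ _ (left_ne_zero_of_mul hy), hδ _ (right_ne_zero_of_mul hy)⟩⟩
  · exact Complex.ofRealCLM.contDiff.comp
      ((β.contDiff.comp contDiff_fst).mul (δ.contDiff.comp contDiff_snd))
  · exact HasCompactSupport.of_support_subset_isCompact
      ((isCompact_closedBall _ _).prod (isCompact_closedBall _ _)) hsupp
  · refine (closure_minimal hsupp (isClosed_closedBall.prod isClosed_closedBall)).trans ?_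
    rintro z ⟨-, hz⟩ h0
    rw [h0] at hz
    norm_num [mem_closedBall] at hz
  · change β y.b * δ y.w = 1
    rw [β.one_of_mem_closedBall hy.1, δ.one_of_mem_closedBall hy.2, mul_one]

theorem haar_real_box (r δ : ℝ) (hr : 0 ≤ r) : haar.real (box (closedBall 0 r) (closedBall 1 δ))
    = r ^ 2 * (Real.pi * dilationMeasure.real (closedBall 1 δ)) := by
  rw [measureReal_def, haar_box, ENNReal.toReal_mul, Complex.volume_closedBall, ENNReal.toReal_mul,
    ENNReal.toReal_pow, ENNReal.toReal_ofReal hr, mul_assoc]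
  rfl

theorem haar_box_lt_top (r : ℝ) {δ : ℝ} (hδ : δ < 1) :
    haar (box (closedBall 0 r) (closedBall 1 δ)) < ∞ := by
  rw [haar_box]
  exact ENNReal.mul_lt_top measure_closedBall_lt_top (dilationMeasure_closedBall_lt_top hδ)

theorem measurableSet_box_closedBall (r δ : ℝ) :
    MeasurableSet (box (closedBall 0 r) (closedBall 1 δ)) :=
  measurableSet_box isClosed_closedBall.measurableSet isClosed_closedBall.measurableSet

/-- The function is dominated by the indicator of a box whose measure is proportional to r², hence
the linear growth in r. -/
theorem norm_toLp_le {f : Sim2 → ℝ} (hf : IsTest fun y => (f y : ℂ)) (h0 : ∀ y, 0 ≤ f y)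
    (h1 : ∀ y, f y ≤ 1) {r : ℝ} (hr : 0 ≤ r)
    (hs : ∀ y, f y ≠ 0 → y ∈ box (closedBall 0 r) (closedBall 1 (1 / 2))) :
    ‖hf.memLp.toLp fun y => (f y : ℂ)‖
      ≤ r * √(Real.pi * dilationMeasure.real (closedBall 1 (1 / 2))) := by
  have hfin := (haar_box_lt_top r (δ := 1 / 2) (by norm_num)).ne
  rw [Lp.norm_toLp]
  have h2 : eLpNorm (fun y => (f y : ℂ)) 2 haar
      ≤ haar (box (closedBall 0 r) (closedBall 1 (1 / 2))) ^ (1 / (2 : ℝ≥0∞).toReal) := by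
    refine (eLpNorm_mono (g := (box (closedBall 0 r) (closedBall 1 (1 / 2))).indicator
      fun _ => (1 : ℝ)) fun y => ?_).trans ?_
    · by_cases hy : y ∈ box (closedBall 0 r) (closedBall 1 (1 / 2))
      · rw [Set.indicator_of_mem hy, Complex.norm_real, Real.norm_of_nonneg (h0 y)]
        simpa using h1 y
      · rw [not_imp_comm.mp (hs y) hy]
        simp
    · rw [eLpNorm_indicator_const (measurableSet_box_closedBall _ _) two_ne_zero
        ENNReal.ofNat_ne_top]
      simp
  refine (ENNReal.toReal_mono (ENNReal.rpow_ne_top_of_nonneg (by simp) hfin) h2).trans ?_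
  rw [← ENNReal.toReal_rpow, ← measureReal_def, haar_real_box _ _ hr, ENNReal.toReal_ofNat,
    ← Real.sqrt_eq_rpow, Real.sqrt_mul (by positivity), Real.sqrt_sq hr]

end Sim2

namespace Sim2

open InnerProductSpace Metric Filter

/-! ### The rank one symbols -/

/-- A slowly decaying weight, supported on a strip `‖w - 1‖ ≤ 1 / 2`. -/
def weight (α : ℝ) : Sim2 → ℝ :=
  (box Set.univ (closedBall 1 (1 / 2))).indicator fun y => (1 + ‖y.b‖ ^ 2) ^ (-α / 2)

theorem measurableSet_strip : MeasurableSet (box Set.univ (closedBall 1 (1 / 2))) :=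
  measurableSet_box MeasurableSet.univ isClosed_closedBall.measurableSet

theorem measurable_weight (α : ℝ) : Measurable (weight α) := by
  refine Measurable.indicator ?_ measurableSet_strip
  have := measurable_b
  fun_prop

theorem weight_nonneg (α : ℝ) (y : Sim2) : 0 ≤ weight α y :=
  Set.indicator_nonneg (fun _ _ => by positivity) y

theorem weight_le_one {α : ℝ} (hα : 0 ≤ α) (y : Sim2) : weight α y ≤ 1 := by
  refine Set.indicator_le' (fun y _ => ?_) (fun _ _ => zero_le_one) y
  exact Real.rpow_le_one_of_one_le_of_nonpos (by nlinarith [sq_nonneg ‖y.b‖]) (by linarith)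

theorem lintegral_weight_rpow_lt_top {α p : ℝ} (hp : 0 < p) (hαp : 2 < α * p) :
    ∫⁻ y, ENNReal.ofReal (weight α y ^ p) ∂haar < ∞ := by
  have h1 : ∀ y, ENNReal.ofReal (weight α y ^ p)
      = (fun z : ℂ × ℂ => ENNReal.ofReal ((1 + ‖z.1‖ ^ 2) ^ (-(α * p) / 2))
        * (closedBall (1 : ℂ) (1 / 2)).indicator 1 z.2) y.coord := by
    intro y
    by_cases hy : y.w ∈ closedBall (1 : ℂ) (1 / 2)
    · have hm : y ∈ box Set.univ (closedBall 1 (1 / 2)) := ⟨Set.mem_univ _, hy⟩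
      simp only [weight, Set.indicator_of_mem hm, coord, Set.indicator_of_mem hy, Pi.one_apply,
        mul_one]
      rw [← Real.rpow_mul (by positivity)]
      congr 2
      ring
    · have hm : y ∉ box Set.univ (closedBall 1 (1 / 2)) := fun h => hy h.2
      simp only [weight, Set.indicator_of_notMem hm, coord, Set.indicator_of_notMem hy, mul_zero]
      rw [Real.zero_rpow hp.ne', ENNReal.ofReal_zero]
  rw [lintegral_congr h1, lintegral_haar fun z : ℂ × ℂ =>
      ENNReal.ofReal ((1 + ‖z.1‖ ^ 2) ^ (-(α * p) / 2)) * (closedBall (1 : ℂ) (1 / 2)).indicator 1 z.2,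
    lintegral_prod_mul (f := fun b : ℂ =>
      ENNReal.ofReal ((1 + ‖b‖ ^ 2) ^ (-(α * p) / 2))) (by fun_prop)
    (measurable_one.indicator isClosed_closedBall.measurableSet).aemeasurable,
    lintegral_indicator_one isClosed_closedBall.measurableSet]
  refine ENNReal.mul_lt_top ?_ (dilationMeasure_closedBall_lt_top (by norm_num))
  -- Integrability at infinity in the plane requires the decay exponent αp to exceed the real
  -- dimension 2.
  refine (integrable_rpow_neg_one_add_norm_sq (r := α * p) ?_).lintegral_lt_top
  simpa using hαp

/-- The symbols `x ↦ s(x) |u⟩⟨v|`, for `s` one of the weights above. -/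
def weightedSymbol (α : ℝ) (x : Sim2) : L2Plane →L[ℂ] L2Plane :=
  (weight α x : ℂ) • rankOne ℂ (ballDom 1 1 zero_le_one : L2Plane) (ballVec 2)

theorem memLpSymbol_weightedSymbol {α p : ℝ} (hp : 0 < p) (hαp : 2 < α * p) :
    MemLpSymbol p (weightedSymbol α) := by
  set u : L2Plane := (ballDom 1 1 zero_le_one : L2Plane) with hu
  have hσ : ∀ x, weightedSymbol α x = rankOne ℂ ((weight α x : ℂ) • u) (ballVec 2) := fun x => by
    rw [map_smul]
    rfl
  have hp' : (0 : ℝ) ≤ 1 / p := by positivity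
  refine ⟨fun φ ψ => ?_, fun x => ?_, ?_⟩
  · simp_rw [hσ, rankOne_apply, inner_smul_right]
    exact ((Complex.measurable_ofReal.comp (measurable_weight α)).mul_const _).const_mul _
  · rw [hσ]
    exact (schattenPow_rankOne_le hp _ _).trans_lt ENNReal.ofReal_lt_top
  · set v' : L2Plane := dufloMoore (1 / p) (ballDom 2 (1 / p) hp') with hv'
    calc ∫⁻ x, schattenPowPMap p
          ((weightedSymbol α x).toLinearMap.compPMap (dufloMoore (1 / p))) ∂haar
        ≤ ∫⁻ x, ENNReal.ofReal ((‖u‖ * ‖v'‖) ^ p) * ENNReal.ofReal (weight α x ^ p) ∂haar := by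
          refine lintegral_mono fun x => ?_
          -- Since K^(1/p) is symmetric, it passes to v, which exhibits a bounded rank one extension
          -- of σ(x)K^(1/p).
          refine (iInf₂_le (rankOne ℂ ((weight α x : ℂ) • u) v') ?_).trans ?_
          · intro (φ : (dufloMoore (1 / p)).domain)
            rw [rankOne_apply, ← inner_dufloMoore_comm]
            change _ = weightedSymbol α x (dufloMoore (1 / p) φ)
            rw [hσ, rankOne_apply]
            rfl
          · refine (schattenPow_rankOne_le hp _ _).trans (le_of_eq ?_)
            rw [← ENNReal.ofReal_mul (by positivity), norm_smul, Complex.norm_real,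
              Real.norm_of_nonneg (weight_nonneg α x), mul_assoc,
              Real.mul_rpow (weight_nonneg α x) (by positivity), mul_comm]
      _ < ∞ := by
          rw [lintegral_const_mul' _ _ ENNReal.ofReal_ne_top]
          exact ENNReal.mul_lt_top ENNReal.ofReal_lt_top (lintegral_weight_rpow_lt_top hp hαp)

/-! ### The pairing with the Wigner transform -/

theorem stronglyMeasurable_coef : StronglyMeasurable coef := by
  have := measurable_w
  exact (Measurable.stronglyMeasurable (by fun_prop)).mul (stronglyMeasurable_inner_rep _ _)

/-- The convolution of `f • coef` with `g`. -/
def coefConv (f g : Sim2 → ℂ) (x : Sim2) : ℂ := ∫ y, f y * g (y⁻¹ * x) * coef y ∂haar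

theorem integrable_coefConv_integrand {f g : Sim2 → ℂ} (hf : IsTest f) (hg : IsTest g) (x : Sim2) :
    Integrable (fun y => f y * g (y⁻¹ * x) * coef y) haar := by
  simpa only [coef, ← mul_assoc] using
    integrable_mul_inner_rep (integrable_mul_translate_mul_norm_sq hf hg x) _ _

theorem hasTrace_weightedSymbol (α : ℝ) {f g : Sim2 → ℂ} (hf : IsTest f) (hg : IsTest g)
    (x : Sim2) :
    HasTrace (weylIntegrand (weightedSymbol α) f g x) (weight α x * coefConv f g x) := by
  have h := hasTrace_weylIntegrand_rankOne (ballDom 1 1 zero_le_one) (ballVec 2) (weight α) hf hg x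
  simp only [coefConv, coef, ← mul_assoc]
  exact h

theorem opTrace_weightedSymbol (α : ℝ) {f g : Sim2 → ℂ} (hf : IsTest f) (hg : IsTest g)
    (x : Sim2) :
    opTrace (weylIntegrand (weightedSymbol α) f g x) = weight α x * coefConv f g x :=
  HasTrace.opTrace_eq (T := weylIntegrand (weightedSymbol α) f g x) dense_domain_dufloMoore
    (hasTrace_weightedSymbol α hf hg x)

theorem stronglyMeasurable_coefConv {f g : Sim2 → ℂ} (hf : IsTest f) (hg : IsTest g) :
    StronglyMeasurable (coefConv f g) := by
  have hm : Measurable fun q : Sim2 × Sim2 => f q.2 * g (q.2⁻¹ * q.1) * coef q.2 :=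
    ((hf.measurable.comp measurable_snd).mul (hg.measurable.comp measurable_inv_mul)).mul
      (stronglyMeasurable_coef.measurable.comp measurable_snd)
  exact hm.stronglyMeasurable.integral_prod_right

theorem exists_bound_coefConv {f g : Sim2 → ℂ} (hf : IsTest f) (hg : IsTest g) :
    ∃ M, ∀ x, ‖coefConv f g x‖ ≤ M := by
  obtain ⟨C, hC0, hC⟩ := hg.exists_bound
  obtain ⟨R, hR, hs⟩ := hf.exists_support_bound
  set N : ℝ := ‖dufloMoore 1 (ballDom 1 1 zero_le_one)‖ * ‖ballVec 2‖
  refine ⟨∫ y, ‖f y‖ * (C * (R ^ 2 * N)) ∂haar, fun x => ?_⟩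
  refine norm_integral_le_of_norm_le (hf.integrable.norm.mul_const _)
    (Eventually.of_forall fun y => ?_)
  rcases eq_or_ne (f y) 0 with h0 | h0
  · simp [h0]
  · have h1 := (hs y h0).2.2
    rw [coef, norm_mul, norm_mul, norm_mul, norm_pow, Complex.norm_real, norm_norm, mul_assoc]
    gcongr
    · exact hC _
    · exact norm_inner_rep_le _ _ _

/-- If x = y(y⁻¹x) with both factors in bounded supports, the product formula bounds b. No bound on
w is needed, as the weight already confines it. -/
theorem exists_support_bound_coefConv {f g : Sim2 → ℂ} (hf : IsTest f) (hg : IsTest g) :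
    ∃ R, ∀ x, coefConv f g x ≠ 0 → ‖x.b‖ ≤ R := by
  obtain ⟨R, hR, hs⟩ := hf.exists_support_bound
  obtain ⟨R', hR', hs'⟩ := hg.exists_support_bound
  refine ⟨R + R * R', fun x hx => ?_⟩
  contrapose! hx
  refine integral_eq_zero_of_ae (Eventually.of_forall fun y => ?_)
  by_contra hne
  have hfg := left_ne_zero_of_mul hne
  have h1 := hs y (left_ne_zero_of_mul hfg)
  have h2 := hs' _ (right_ne_zero_of_mul hfg)
  refine hx.not_ge ?_
  calc ‖x.b‖ = ‖(y * (y⁻¹ * x)).b‖ := by rw [mul_inv_cancel_left]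
    _ ≤ ‖y.b‖ + ‖y.w‖ * ‖(y⁻¹ * x).b‖ := by
        rw [mul_b, ← norm_mul]
        exact norm_add_le _ _
    _ ≤ R + R * R' := by
        gcongr
        exacts [h1.1, h1.2.2, h2.1]

theorem integrable_weight_mul_coefConv {α : ℝ} (hα : 0 ≤ α) {f g : Sim2 → ℂ} (hf : IsTest f)
    (hg : IsTest g) : Integrable (fun x => (weight α x : ℂ) * coefConv f g x) haar := by
  obtain ⟨M, hM⟩ := exists_bound_coefConv hf hg
  obtain ⟨R, hR⟩ := exists_support_bound_coefConv hf hg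
  have hfin := (haar_box_lt_top R (δ := 1 / 2) (by norm_num)).ne
  have hm : Measurable fun x => (weight α x : ℂ) * coefConv f g x :=
    (Complex.measurable_ofReal.comp (measurable_weight α)).mul
      (stronglyMeasurable_coefConv hf hg).measurable
  have hi := Measure.integrableOn_of_bounded (M := M) hfin hm.aestronglyMeasurable
    (Eventually.of_forall fun x => by
      rw [norm_mul, Complex.norm_real, Real.norm_of_nonneg (weight_nonneg α x)]
      exact (mul_le_of_le_one_left (norm_nonneg _) (weight_le_one hα x)).trans (hM x))
  rw [← integrable_indicator_iff (measurableSet_box_closedBall _ _)] at hi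
  rwa [Set.indicator_eq_self.mpr] at hi
  intro x hx
  refine ⟨by simpa using hR x (right_ne_zero_of_mul hx), ?_⟩
  have h1 : weight α x ≠ 0 := fun h => left_ne_zero_of_mul hx (by rw [h, Complex.ofReal_zero])
  exact (Set.mem_of_indicator_ne_zero h1).2

theorem weylPairingExists_weightedSymbol {α : ℝ} (hα : 0 ≤ α) {f g : Sim2 → ℂ} (hf : IsTest f)
    (hg : IsTest g) : WeylPairingExists (weightedSymbol α) f g := by
  refine ⟨Eventually.of_forall fun x => ⟨_, hasTrace_weightedSymbol α hf hg x⟩, ?_⟩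
  simp_rw [opTrace_weightedSymbol α hf hg]
  exact integrable_weight_mul_coefConv hα hf hg

theorem weylPairing_weightedSymbol (α : ℝ) {f g : Sim2 → ℂ} (hf : IsTest f) (hg : IsTest g) :
    weylPairing (weightedSymbol α) f g = ∫ x, (weight α x : ℂ) * coefConv f g x ∂haar := by
  simp_rw [weylPairing, opTrace_weightedSymbol α hf hg]

/-! ### Lower bounds for the pairing -/

theorem norm_mem_of_mem_closedBall_one {w : ℂ} (hw : w ∈ closedBall (1 : ℂ) (1 / 2)) :
    1 / 2 ≤ ‖w‖ ∧ ‖w‖ ≤ 2 := by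
  rw [mem_closedBall_iff_norm] at hw
  have h1 := norm_sub_norm_le 1 w
  have h2 := norm_sub_norm_le w 1
  rw [norm_sub_rev, norm_one] at h1
  rw [norm_one] at h2
  constructor <;> linarith

/-- Translating a point of a small box by the inverse of an element near `1`. -/
theorem inv_mul_mem_box {r : ℝ} (hr : 1 ≤ r) {x y : Sim2}
    (hx : x ∈ box (closedBall 0 (r / 4)) (closedBall 1 (1 / 16)))
    (hy : y ∈ box (closedBall 0 (1 / 4)) (closedBall 1 (1 / 16))) :
    y⁻¹ * x ∈ box (closedBall 0 r) (closedBall 1 (1 / 4)) := by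
  obtain ⟨hx1, hx2⟩ := hx
  obtain ⟨hy1, hy2⟩ := hy
  -- Dividing by w costs at most a factor 2: 2(r/4 + 1/4) ≤ r because r ≥ 1, and 2(1/16 + 1/16) =
  -- 1/4.
  have hyw := (norm_mem_of_mem_closedBall_one (closedBall_subset_closedBall (by norm_num) hy2)).1
  rw [mem_closedBall_zero_iff] at hx1 hy1
  rw [mem_closedBall_iff_norm] at hx2 hy2
  have hpos : 0 < ‖y.w‖ := by linarith
  constructor
  · rw [mem_closedBall_zero_iff, mul_b, inv_b, inv_w,
      show -(y.w⁻¹ * y.b) + y.w⁻¹ * x.b = y.w⁻¹ * (x.b - y.b) by ring, norm_mul, norm_inv,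
      inv_mul_le_iff₀ hpos]
    have := norm_sub_le x.b y.b
    nlinarith
  · rw [mem_closedBall_iff_norm, mul_w, inv_w,
      show y.w⁻¹ * x.w - 1 = y.w⁻¹ * (x.w - y.w) by
        rw [mul_sub, inv_mul_cancel₀ y.w_ne], norm_mul, norm_inv, inv_mul_le_iff₀ hpos]
    have h1 : ‖x.w - y.w‖ ≤ ‖x.w - 1‖ + ‖y.w - 1‖ := by
      rw [show x.w - y.w = (x.w - 1) - (y.w - 1) by ring]
      exact norm_sub_le _ _
    linarith

/-- There is a test function `f` such that the pairing of `f` with bump functions at scale `r`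
grows like `r ^ (2 - α)`. -/
theorem exists_pairing_lower_bound {α : ℝ} (hα : 0 ≤ α) : ∃ f : Sim2 → ℂ, IsTest f ∧
    ∃ c : ℝ, 0 < c ∧ ∀ r : ℝ, 1 ≤ r → ∀ g : Sim2 → ℝ, IsTest (fun y => (g y : ℂ)) →
      (∀ y, 0 ≤ g y) → (∀ y ∈ box (closedBall 0 r) (closedBall 1 (1 / 4)), g y = 1) →
      c * r ^ (2 - α) ≤ (weylPairing (weightedSymbol α) f fun y => (g y : ℂ)).re := by
  obtain ⟨f, hf, hf0, -, hf1, hfs⟩ := exists_isTest (r := 1 / 4) (by norm_num)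
  set κ : ℝ := (∫ ξ in closedBall (0 : ℂ) 1, ‖ξ‖ ^ 2 / 2) / 8 with hκ
  have hκ0 : 0 < κ := div_pos setIntegral_norm_sq_pos (by norm_num)
  set V : Set Sim2 := box (closedBall 0 (1 / 4)) (closedBall 1 (1 / 16)) with hV
  set ν : ℝ := Real.pi * dilationMeasure.real (closedBall 1 (1 / 16)) with hν
  have hν0 : 0 < ν := mul_pos Real.pi_pos (ENNReal.toReal_pos
    (dilationMeasure_closedBall_pos (by norm_num)).ne'
    (dilationMeasure_closedBall_lt_top (by norm_num)).ne)
  have hVr : haar.real V = (1 / 4) ^ 2 * ν := haar_real_box _ _ (by norm_num)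
  have hV0 : 0 < haar.real V := by rw [hVr]; positivity
  refine ⟨_, hf, 2 ^ (-α / 2) * (κ * haar.real V) * ((1 / 4) ^ 2 * ν), by positivity,
    fun r hr g hg hg0 hg1 => ?_⟩
  have hr0 : 0 < r := by linarith
  have hcoef : ∀ y, f y ≠ 0 → κ ≤ (coef y).re := by
    intro y hy
    obtain ⟨h1, h2⟩ := hfs y hy
    have h3 := norm_mem_of_mem_closedBall_one h2
    rw [mem_closedBall_zero_iff] at h1
    exact coef_re_ge (by linarith) h3.1 h3.2
  have hint := fun x => (integrable_coefConv_integrand hf hg x)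
  have hre : ∀ x, (coefConv (fun y => (f y : ℂ)) (fun y => (g y : ℂ)) x).re
      = ∫ y, f y * g (y⁻¹ * x) * (coef y).re ∂haar := by
    intro x
    have h1 := integral_re (hint x)
    simp only [RCLike.re_eq_complex_re] at h1
    rw [coefConv, ← h1]
    congr 1
    ext y
    rw [← Complex.ofReal_mul, Complex.re_ofReal_mul]
  have hint' : ∀ x, Integrable (fun y => f y * g (y⁻¹ * x) * (coef y).re) haar := by
    intro x
    refine (hint x).re.congr (Eventually.of_forall fun y => ?_)
    simp only [RCLike.re_eq_complex_re]
    rw [← Complex.ofReal_mul, Complex.re_ofReal_mul]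
  -- The sign of Re `coef` is known only near the identity, and f vanishes elsewhere. This
  -- positivity allows the integrals to be bounded below on subsets.
  have hnn : ∀ x y, 0 ≤ f y * g (y⁻¹ * x) * (coef y).re := by
    intro x y
    rcases eq_or_ne (f y) 0 with h0 | h0
    · simp [h0]
    · exact mul_nonneg (mul_nonneg (hf0 y) (hg0 _)) (hκ0.le.trans (hcoef y h0))
  have hconv0 : ∀ x, 0 ≤ (coefConv (fun y => (f y : ℂ)) (fun y => (g y : ℂ)) x).re := fun x => by
    rw [hre]
    exact integral_nonneg (hnn x)
  set X : Set Sim2 := box (closedBall 0 (r / 4)) (closedBall 1 (1 / 16)) with hX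
  have hconv : ∀ x ∈ X, κ * haar.real V
      ≤ (coefConv (fun y => (f y : ℂ)) (fun y => (g y : ℂ)) x).re := by
    intro x hx
    rw [hre]
    refine mul_measureReal_le_integral (hint' x) (hnn x) (measurableSet_box_closedBall _ _)
      (haar_box_lt_top _ (by norm_num)).ne fun y hy => ?_
    have h1 : f y = 1 := hf1 y ⟨hy.1, closedBall_subset_closedBall (by norm_num) hy.2⟩
    rw [h1, hg1 _ (inv_mul_mem_box hr hx hy), one_mul, one_mul]
    exact hcoef y (by rw [h1]; exact one_ne_zero)
  -- On X one has 1 + ‖b‖² ≤ 2r², and the exponent -α/2 is nonpositive.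
  have hweight : ∀ x ∈ X, 2 ^ (-α / 2) * r ^ (-α) ≤ weight α x := by
    rintro x ⟨h1, h2⟩
    have hm : x ∈ box Set.univ (closedBall 1 (1 / 2)) :=
      ⟨Set.mem_univ _, closedBall_subset_closedBall (by norm_num) h2⟩
    rw [weight, Set.indicator_of_mem hm]
    rw [mem_closedBall_zero_iff] at h1
    have h3 : r ^ (-α) = (r ^ 2) ^ (-α / 2) := by
      rw [← Real.rpow_natCast, ← Real.rpow_mul hr0.le]
      congr 1
      push_cast
      ring
    rw [h3, ← Real.mul_rpow zero_le_two (by positivity)]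
    refine Real.rpow_le_rpow_of_nonpos (by positivity) ?_ (by linarith)
    nlinarith [norm_nonneg x.b]
  have hpair : (weylPairing (weightedSymbol α) (fun y => (f y : ℂ)) fun y => (g y : ℂ)).re
      = ∫ x, weight α x * (coefConv (fun y => (f y : ℂ)) (fun y => (g y : ℂ)) x).re ∂haar := by
    rw [weylPairing_weightedSymbol α hf hg]
    have h1 := integral_re (integrable_weight_mul_coefConv hα hf hg)
    simp only [RCLike.re_eq_complex_re, Complex.re_ofReal_mul] at h1
    exact h1.symm
  have hpi : Integrable (fun x => weight α x
      * (coefConv (fun y => (f y : ℂ)) (fun y => (g y : ℂ)) x).re) haar := by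
    refine (integrable_weight_mul_coefConv hα hf hg).re.congr (Eventually.of_forall fun x => ?_)
    simp only [RCLike.re_eq_complex_re, Complex.re_ofReal_mul]
  rw [hpair]
  have hmain := mul_measureReal_le_integral hpi
    (fun x => mul_nonneg (weight_nonneg α x) (hconv0 x)) (measurableSet_box_closedBall _ _)
    (haar_box_lt_top (r / 4) (δ := 1 / 16) (by norm_num)).ne
    fun x hx => mul_le_mul (hweight x hx) (hconv x hx) (by positivity) (weight_nonneg α x)
  refine le_of_eq_of_le ?_ hmain
  rw [haar_real_box (r / 4) (1 / 16) (by positivity), ← hν, sub_eq_add_neg, Real.rpow_add hr0, Real.rpow_two]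
  ring

/-- With f fixed, Cauchy–Schwarz bounds the pairing by a multiple of ‖g‖, hence of r, against the
lower bound c r^(2-α). -/
theorem not_weylIsBounded_weightedSymbol {α : ℝ} (hα : 0 ≤ α) (hα1 : α < 1) :
    ¬ WeylIsBounded (weightedSymbol α) := by
  rintro ⟨T, hT⟩
  obtain ⟨f, hf, c, hc, hlow⟩ := exists_pairing_lower_bound hα
  set D : ℝ := √(Real.pi * dilationMeasure.real (closedBall 1 (1 / 2)))
  set E : ℝ := ‖T (hf.memLp.toLp f)‖
  have hub : ∀ r : ℝ, 1 ≤ r → c * r ^ (1 - α) ≤ 2 * D * E := by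
    intro r hr
    have hr0 : 0 < r := by linarith
    obtain ⟨g, hg, hg0, hg1, hgo, hgs⟩ := exists_isTest hr0
    have h1 := hlow r hr g hg hg0 hgo
    rw [← hT f _ hf hg] at h1
    -- As g is real, the bilinear pairing is an inner product.
    have h2 : ∫ x, T (hf.memLp.toLp f) x * (g x : ℂ) ∂haar
        = inner ℂ (hg.memLp.toLp fun y => (g y : ℂ)) (T (hf.memLp.toLp f)) := by
      rw [L2.inner_def]
      refine integral_congr_ae ?_
      filter_upwards [hg.memLp.coeFn_toLp] with x hx
      rw [hx, RCLike.inner_apply, Complex.conj_ofReal]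
    have h3 : c * r ^ (2 - α) ≤ 2 * r * D * E := by
      rw [h2] at h1
      refine h1.trans ((Complex.re_le_norm _).trans ((norm_inner_le_norm _ _).trans ?_))
      exact mul_le_mul_of_nonneg_right (norm_toLp_le hg hg0 hg1 (by positivity) hgs) (norm_nonneg _)
    have h4 : r ^ (2 - α) = r * r ^ (1 - α) := by
      rw [show 2 - α = 1 + (1 - α) by ring, Real.rpow_add hr0, Real.rpow_one]
    rw [h4] at h3
    refine le_of_mul_le_mul_left ?_ hr0
    linarith
  have htend : Tendsto (fun r : ℝ => c * r ^ (1 - α)) atTop atTop :=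
    (tendsto_rpow_atTop (by linarith)).const_mul_atTop hc
  obtain ⟨r, hr, hr1⟩ := ((htend.eventually_gt_atTop (2 * D * E)).and
    (eventually_ge_atTop 1)).exists
  exact (hub r hr1).not_gt hr

end Sim2

end

theorem theorem3p3 (p : ℝ) (hp : 2 < p) :
    ∃ σ : Sim2 → Sim2.L2Plane →L[ℂ] Sim2.L2Plane,
      Sim2.MemLpSymbol p σ ∧
      (∀ f g : Sim2 → ℂ, Sim2.IsTest f → Sim2.IsTest g → Sim2.WeylPairingExists σ f g) ∧
      ¬ Sim2.WeylIsBounded σ := by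
  have hp0 : 0 < p := by linarith
  -- The condition α > 2/p puts the symbol in the space and α < 1 destroys boundedness; both can
  -- hold exactly because p > 2.
  obtain ⟨α, h1, h2⟩ := exists_between ((div_lt_one hp0).mpr hp)
  have h0 : 0 ≤ α := (div_pos two_pos hp0).le.trans h1.le
  exact ⟨Sim2.weightedSymbol α,
    Sim2.memLpSymbol_weightedSymbol hp0 ((div_lt_iff₀ hp0).mp h1),
    fun f g hf hg => Sim2.weylPairingExists_weightedSymbol h0 hf hg,
    Sim2.not_weylIsBounded_weightedSymbol h0 h2⟩
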